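/- Let $X>0$. A pair $(u,v)$ of real functions solves the Prandtl equation (with outer flow $1$) globally in time on $[0,X]$ if $$\partial_t u+u\,\partial_x u+v\,\partial_y u-\partial_y^2u=0,\qquad \partial_x u+\partial_y v=0\qquad\text{for } t>0,\ 0<x\le X,\ y>0,$$ $u|_{y=0}=v|_{y=0}=0$ and $\lim_{y\to+\infty}u(t,x,y)=1$; write $u_0=u|_{t=0}$, $u_1=u|_{x=0}$ for the initial and inflow data. Such a (classical) solution with $\partial_y u>0$ has the Crocco transform $w(\tau,\xi,\eta)$, $0\le\eta<1$, defined by $w(t,x,u(t,x,y))=\partial_y u(t,x,y)$. It is a *global Oleinik monotone solution* if $w\in C^2([0,\infty)\times[0,X]\times[0,1))\cap C^3((0,\infty)\times(0,X]\times(0,1))$ and, as $\eta\to1$, locally uniformly in $(\tau,\xi)\in[0,\infty)\times[0,X]$, one has $w\to0$, $\partial_\xi w\to0$, $\partial_\tau w\to 0$ and $w\,\partial_\eta^2w\to l(\tau,\xi)$ for some continuous function $l$. It is *steady* if $u$ does not depend on $t$. For $c_0\in(0,1)$, $\mu\in(0,\frac1{100})$, $\alpha_0\in(0,1)$, $C_1>0$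 and $\beta>0$ put $$b=\tfrac{c_0}{4}e^{-\beta X}e^{-8/3},\qquad K=e^X\max\{2,2C_1^{1/\alpha_0-1}\},$$ $$\delta=\min\Big\{\tfrac1{10}\min_{\alpha\in[\alpha_0/2,\alpha_0]}\alpha(1-\alpha)b^2,\ \tfrac1{321e^X},\ \tfrac{\min\{1,C_1\}}{b\,2^{\alpha_0}}\Big\},$$ and say that $u$ has *admissible data* (for these constants) if, at all points of $[0,\infty)\times[0,X]\times[0,1)$ with $\tau=0$ or $\xi=0$, $$c_0(1-\eta)\le w\le c_0^{-1}(1-\eta)\sqrt{-\ln(\mu(1-\eta))},$$ $$-C_1(1-\eta)^{\alpha_0}\le\partial_\xi w+\partial_\tau w\le\frac{(\delta b)^{1/\alpha_0}}{K}(1-\eta),\qquad -C_1(1-\eta)^{\alpha_0}\le\partial_\tau w\le b\,\delta\,(1-\eta)^{\alpha_0}.$$ **Theorem.** For all $\mu\in(0,\frac1{100})$, $c_0\in(0,1)$ and $X>0$ there is $\beta>0$, depending only on $\mu,c_0,X$, such that the following holds for all $\alpha_0\in(0,1)$ and $C_1>0$. Let $\bar u$ be a steady and $u$ a global Oleinik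 monotone solution on $[0,X]$, with Crocco transforms $\bar w$ and $w$, both with admissible data for the constants $\mu,c_0,X,\alpha_0,C_1,\beta$, and suppose that $\partial_\eta^2\bar w\le0$ for $0<\xi\le X$, $0<\eta<1$. (i) *Orbital stability.* For every $\epsilon>0$ there is $\delta_\epsilon>0$, depending only on $\epsilon,\mu,\alpha_0,c_0,C_1,X$, such that if $$\|\partial_yu_1-\partial_y\bar u_1\|_{L^\infty([0,\infty)\times[0,\infty))}\le\delta_\epsilon,\qquad \|\partial_yu_0-\partial_y\bar u_0\|_{L^\infty([0,X]\times[0,\infty))}\le\delta_\epsilon,$$ then $\|u-\bar u\|_{L^\infty([0,\infty)\times[0,X]\times[0,\infty))}\le\epsilon$. (ii) *Asymptotic stability.* Let $\beta_0\in(0,b^2\alpha_0(1-\alpha_0))$ and $C_2>0$, and suppose that $w_1=w|_{\xi=0}$ and $\bar w_1=\bar w|_{\xi=0}$ satisfy $$|w_1(\tau,\eta)-\bar w_1(\eta)|\le C_2e^{-\beta_0\tau}(1-\eta)^{\alpha_0}\qquad\text{for }\tau\ge0,\ 0\le\eta<1 .$$ Then for every $y_0>0$ there is a constant $C>0$, depending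 only on $y_0,\alpha_0,C_2,\mu,c_0,X$, such that $$\|u(t)-\bar u\|_{L^\infty([0,X]\times[0,y_0])}\le C e^{-\beta_0t}\qquad\text{for all }t\ge0;$$ moreover $\|u(t)-\bar u\|_{L^\infty([0,X]\times[0,\infty))}\to0$ as $t\to+\infty$. -/

import Mathlib

open Set Filter Topology

noncomputable section

namespace Prandtl

/-- Partial derivative in the time variable on `[0, ∞)` (one-sided at `0`). -/
def dT (f : ℝ → ℝ → ℝ → ℝ) (t x y : ℝ) : ℝ :=
  derivWithin (fun s => f s x y) (Ici 0) t

/-- Partial derivative in the tangential variable on `[0, X]` (one-sided at the end points). -/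
def dX (X : ℝ) (f : ℝ → ℝ → ℝ → ℝ) (t x y : ℝ) : ℝ :=
  derivWithin (fun s => f t s y) (Icc 0 X) x

/-- Partial derivative in the third variable (`y`, or `η` in Crocco variables), one-sided at `0`.
At `0 ≤ η < 1` it only depends on the values of `f` at third arguments in `[0, 1)`. -/
def dY (f : ℝ → ℝ → ℝ → ℝ) (t x y : ℝ) : ℝ :=
  derivWithin (fun s => f t x s) (Ici 0) y

/-- Second partial derivative in the third variable. -/
def dYY (f : ℝ → ℝ → ℝ → ℝ) : ℝ → ℝ → ℝ → ℝ := dY (dY f)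

/-- A function of three variables as a function on `ℝ × ℝ × ℝ`. -/
def unc (f : ℝ → ℝ → ℝ → ℝ) (p : ℝ × ℝ × ℝ) : ℝ := f p.1 p.2.1 p.2.2

/-- The closed physical domain `[0, ∞) × [0, X] × [0, ∞)`. -/
def physDomain (X : ℝ) : Set (ℝ × ℝ × ℝ) := Ici 0 ×ˢ Icc 0 X ×ˢ Ici 0

/-- The Crocco domain `[0, ∞) × [0, X] × [0, 1)`, closed except for the edge `η = 1`. -/
def croccoDomain (X : ℝ) : Set (ℝ × ℝ × ℝ) := Ici 0 ×ˢ Icc 0 X ×ˢ Ico 0 1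

/-- The set `(0, ∞) × (0, X] × (0, 1)`. -/
def croccoInterior (X : ℝ) : Set (ℝ × ℝ × ℝ) := Ioi 0 ×ˢ Ioc 0 X ×ˢ Ioo 0 1

/-- `(u, v)` is a global-in-time classical solution of the Prandtl equation with outer flow `1`:
`∂ₜu + u ∂ₓu + v ∂_y u - ∂_y² u = 0` and `∂ₓu + ∂_y v = 0` for `t > 0`, `0 < x ≤ X`, `y > 0`,
with `u = v = 0` at `y = 0` and `u → 1` as `y → ∞`. The initial and inflow data are the
restrictions of `u` to `t = 0` and to `x = 0`. -/
structure IsPrandtlSolution (X : ℝ) (u v : ℝ → ℝ → ℝ → ℝ) : Prop where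
  contDiffOn_u : ContDiffOn ℝ 2 (unc u) (physDomain X)
  continuousOn_v : ∀ t > 0, ∀ x ∈ Ioc 0 X, ContinuousOn (v t x) (Ici 0)
  momentum : ∀ t > 0, ∀ x ∈ Ioc 0 X, ∀ y > 0,
    dT u t x y + u t x y * dX X u t x y + v t x y * dY u t x y - dYY u t x y = 0
  divergence : ∀ t > 0, ∀ x ∈ Ioc 0 X, ∀ y > 0, HasDerivAt (v t x) (-dX X u t x y) y
  u_wall : ∀ t ≥ 0, ∀ x ∈ Icc 0 X, u t x 0 = 0
  v_wall : ∀ t > 0, ∀ x ∈ Ioc 0 X, v t x 0 = 0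
  u_far : ∀ t ≥ 0, ∀ x ∈ Icc 0 X, Tendsto (u t x) atTop (𝓝 1)

/-- `g` tends to `l (τ, ξ)` as `η → 1⁻`, locally uniformly in `(τ, ξ) ∈ [0, ∞) × [0, X]`, with `l`
continuous; that is, `g` extends continuously by `l` to the edge `η = 1`. -/
def HasEdgeLimit (X : ℝ) (g : ℝ → ℝ → ℝ → ℝ) (l : ℝ → ℝ → ℝ) : Prop :=
  ∀ τ ≥ 0, ∀ ξ ∈ Icc 0 X,
    Tendsto (unc g) (𝓝[croccoDomain X] (τ, ξ, 1)) (𝓝 (l τ ξ))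

/-- `u` is a global Oleinik monotone solution of the Prandtl equation on `[0, X]`, and `w` is its
Crocco transform, `w(t, x, u(t, x, y)) = ∂_y u(t, x, y)`. As `u(t, x, ·)` maps `[0, ∞)` bijectively
onto `[0, 1)`, the identity `crocco` determines `w` on the Crocco domain; there the Crocco equation
`-∂_τ w - η ∂_ξ w + w² ∂_η² w = 0` and the condition `w ∂_η w = 0` at `η = 0` are consequences of
the Prandtl equation for `u`. The `C²` regularity of `u` is a consequence of that of `w`. -/
structure IsOleinikSolution (X : ℝ) (u w : ℝ → ℝ → ℝ → ℝ) : Prop where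
  prandtl : ∃ v, IsPrandtlSolution X u v
  monotone : ∀ t ≥ 0, ∀ x ∈ Icc 0 X, ∀ y ≥ 0, 0 < dY u t x y
  crocco : ∀ t ≥ 0, ∀ x ∈ Icc 0 X, ∀ y ≥ 0, w t x (u t x y) = dY u t x y
  contDiffOn_two : ContDiffOn ℝ 2 (unc w) (croccoDomain X)
  contDiffOn_three : ContDiffOn ℝ 3 (unc w) (croccoInterior X)
  edge_w : HasEdgeLimit X w (fun _ _ => 0)
  edge_dX : HasEdgeLimit X (dX X w) (fun _ _ => 0)
  edge_dT : HasEdgeLimit X (dT w) (fun _ _ => 0)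
  edge_dYY : ∃ l : ℝ → ℝ → ℝ, HasEdgeLimit X (fun τ ξ η => w τ ξ η * dYY w τ ξ η) l

/-- `b = (c₀ / 4) e^{-β X} e^{-8/3}`. -/
def bConst (c₀ β X : ℝ) : ℝ := c₀ / 4 * Real.exp (-(β * X)) * Real.exp (-(8 / 3))

/-- `K = e^X max {2, 2 C₁^{1/α₀ - 1}}`. -/
def kConst (X α₀ C₁ : ℝ) : ℝ := Real.exp X * max 2 (2 * C₁ ^ (1 / α₀ - 1))

/-- `δ = min {(1/10) min_{α ∈ [α₀/2, α₀]} α (1 - α) b², 1 / (321 e^X), min {1, C₁} / (b 2^{α₀})}`. -/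
def deltaConst (X α₀ C₁ b : ℝ) : ℝ :=
  min (1 / 10 * sInf ((fun α : ℝ => α * (1 - α) * b ^ 2) '' Icc (α₀ / 2) α₀))
    (min (1 / (321 * Real.exp X)) (min 1 C₁ / (b * 2 ^ α₀)))

/-- The conditions on the initial and inflow data, in Crocco variables: on the part
`{τ = 0} ∪ {ξ = 0}` of the boundary,
`c₀ (1 - η) ≤ w ≤ c₀⁻¹ (1 - η) √(-ln (μ (1 - η)))`,
`-C₁ (1 - η)^{α₀} ≤ ∂_ξ w + ∂_τ w ≤ (δ b)^{1/α₀} / K (1 - η)`,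
`-C₁ (1 - η)^{α₀} ≤ ∂_τ w ≤ b δ (1 - η)^{α₀}`. -/
def DataBounds (X μ c₀ α₀ C₁ b : ℝ) (w : ℝ → ℝ → ℝ → ℝ) : Prop :=
  ∀ τ ≥ 0, ∀ ξ ∈ Icc 0 X, ∀ η ∈ Ico (0 : ℝ) 1, (τ = 0 ∨ ξ = 0) →
    (c₀ * (1 - η) ≤ w τ ξ η ∧
      w τ ξ η ≤ c₀⁻¹ * (1 - η) * Real.sqrt (-Real.log (μ * (1 - η)))) ∧
    (-C₁ * (1 - η) ^ α₀ ≤ dX X w τ ξ η + dT w τ ξ η ∧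
      dX X w τ ξ η + dT w τ ξ η
        ≤ (deltaConst X α₀ C₁ b * b) ^ (1 / α₀) / kConst X α₀ C₁ * (1 - η)) ∧
    (-C₁ * (1 - η) ^ α₀ ≤ dT w τ ξ η ∧
      dT w τ ξ η ≤ b * deltaConst X α₀ C₁ b * (1 - η) ^ α₀)

/-- The standing hypotheses of the stability theorem: `ū` is a steady and `u` a global Oleinik
monotone solution, with Crocco transforms `w̄` and `w`; `∂_η² w̄ ≤ 0`; and the data of both
solutions satisfy `DataBounds` with the same constants. -/
structure StabilityHyp (X μ c₀ α₀ C₁ b : ℝ) (ubar wbar : ℝ → ℝ → ℝ)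
    (u w : ℝ → ℝ → ℝ → ℝ) : Prop where
  steady : IsOleinikSolution X (fun _ => ubar) (fun _ => wbar)
  unsteady : IsOleinikSolution X u w
  concave : ∀ ξ ∈ Ioc 0 X, ∀ η ∈ Ioo (0 : ℝ) 1, dYY (fun _ => wbar) 0 ξ η ≤ 0
  data_bar : DataBounds X μ c₀ α₀ C₁ b (fun _ => wbar)
  data : DataBounds X μ c₀ α₀ C₁ b w

end Prandtl

end

/-!
In the Crocco variables the Prandtl system becomes `-∂_τ w - η ∂_ξ w + w² ∂_η² w = 0` with the
Neumann condition `∂_η w = 0` at `η = 0`, a degenerate parabolic equation with a maximum principle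
on `τ ≥ 0`, `0 ≤ ξ ≤ X`, `0 ≤ η < 1` whose parabolic boundary consists of `τ = 0`, `ξ = 0` and the
edge `η = 1`. The upper barrier `c₀⁻¹ (1 - η) √(-log (μ (1 - η)))` and the lower barrier
`(c₀ / 3) e^{-β ξ} (1 - η³)` are propagated from the data. For two solutions, the concavity of `w̄`
gives the zeroth-order term in the equation of `w - w̄` the favourable sign, so `|w - w̄|` stays
below any nonnegative concave supersolution: constants for orbital stability, and multiples of
`e^{-κ τ} (1 - η)^α` with `κ ≤ b² α (1 - α)` for decay. Since `∫₀^u dη / w = y`, smallness of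
`w - w̄` becomes smallness of `u - ū`; the upper barrier controls how close `u` is to `1` when `y`
is large.
-/

open Set Filter Topology

noncomputable section

namespace Prandtl

/-- The product `[0, ∞) × [0, X] × S`: the physical domain for `S = [0, ∞)`, the Crocco domain for
`S = [0, 1)`. -/
def box (X : ℝ) (S : Set ℝ) : Set (ℝ × ℝ × ℝ) := Ici 0 ×ˢ Icc 0 X ×ˢ S

/-- `S` is a relatively open subset of `[0, ∞)`, so that derivatives within `S` and within
`[0, ∞)` agree at its points. -/
structure RelOpen (S : Set ℝ) : Prop where
  subset : S ⊆ Ici 0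
  mem_nhdsWithin : ∀ y ∈ S, S ∈ 𝓝[Ici 0] y

lemma relOpen_Ici : RelOpen (Ici 0) := ⟨subset_rfl, fun _ _ => self_mem_nhdsWithin⟩

lemma relOpen_Ico : RelOpen (Ico 0 1) where
  subset := Ico_subset_Ici_self
  mem_nhdsWithin _ hy := inter_mem self_mem_nhdsWithin (mem_nhdsWithin_of_mem_nhds
    (Iio_mem_nhds hy.2))

lemma RelOpen.uniqueDiffOn {S : Set ℝ} (hS : RelOpen S) : UniqueDiffOn ℝ S := fun y hy =>
  (uniqueDiffOn_Ici (0 : ℝ) y (hS.subset hy)).mono_nhds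
    (nhdsWithin_le_of_mem (hS.mem_nhdsWithin y hy))

lemma uniqueDiffOn_box {X : ℝ} (hX : 0 < X) {S : Set ℝ} (hS : RelOpen S) :
    UniqueDiffOn ℝ (box X S) :=
  (uniqueDiffOn_Ici 0).prod ((uniqueDiffOn_Icc hX).prod hS.uniqueDiffOn)

section Partials

variable {X : ℝ} {S : Set ℝ} {f : ℝ → ℝ → ℝ → ℝ} {t x y : ℝ}

lemma hasDerivWithinAt_slice_fst (hf : DifferentiableOn ℝ (unc f) (box X S))
    (h : (t, x, y) ∈ box X S) :
    HasDerivWithinAt (fun s => f s x y)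
      (fderivWithin ℝ (unc f) (box X S) (t, x, y) (1, 0, 0)) (Ici 0) t :=
  (hf _ h).hasFDerivWithinAt.comp_hasDerivWithinAt (f := fun s => (s, x, y)) t
    ((hasDerivWithinAt_id t _).prodMk (hasDerivWithinAt_const t _ (x, y)))
    fun _ hs => ⟨hs, h.2⟩

lemma hasDerivWithinAt_slice_snd (hf : DifferentiableOn ℝ (unc f) (box X S))
    (h : (t, x, y) ∈ box X S) :
    HasDerivWithinAt (fun s => f t s y)
      (fderivWithin ℝ (unc f) (box X S) (t, x, y) (0, 1, 0)) (Icc 0 X) x :=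
  (hf _ h).hasFDerivWithinAt.comp_hasDerivWithinAt (f := fun s => (t, s, y)) x
    ((hasDerivWithinAt_const x _ t).prodMk
      ((hasDerivWithinAt_id x _).prodMk (hasDerivWithinAt_const x _ y)))
    fun _ hs => ⟨h.1, hs, h.2.2⟩

lemma hasDerivWithinAt_slice_thd (hS : RelOpen S) (hf : DifferentiableOn ℝ (unc f) (box X S))
    (h : (t, x, y) ∈ box X S) :
    HasDerivWithinAt (f t x)
      (fderivWithin ℝ (unc f) (box X S) (t, x, y) (0, 0, 1)) (Ici 0) y :=
  ((hf _ h).hasFDerivWithinAt.comp_hasDerivWithinAt (f := fun s => (t, x, s)) y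
    ((hasDerivWithinAt_const y S t).prodMk
      ((hasDerivWithinAt_const y S x).prodMk (hasDerivWithinAt_id y S)))
    fun _ hs => ⟨h.1, h.2.1, hs⟩).mono_of_mem_nhdsWithin (hS.mem_nhdsWithin y h.2.2)

lemma dT_eq (hf : DifferentiableOn ℝ (unc f) (box X S)) (h : (t, x, y) ∈ box X S) :
    dT f t x y = fderivWithin ℝ (unc f) (box X S) (t, x, y) (1, 0, 0) :=
  (hasDerivWithinAt_slice_fst hf h).derivWithin (uniqueDiffOn_Ici 0 t h.1)

lemma dX_eq (hX : 0 < X) (hf : DifferentiableOn ℝ (unc f) (box X S)) (h : (t, x, y) ∈ box X S) :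
    dX X f t x y = fderivWithin ℝ (unc f) (box X S) (t, x, y) (0, 1, 0) :=
  (hasDerivWithinAt_slice_snd hf h).derivWithin (uniqueDiffOn_Icc hX x h.2.1)

lemma dY_eq (hS : RelOpen S) (hf : DifferentiableOn ℝ (unc f) (box X S))
    (h : (t, x, y) ∈ box X S) :
    dY f t x y = fderivWithin ℝ (unc f) (box X S) (t, x, y) (0, 0, 1) :=
  (hasDerivWithinAt_slice_thd hS hf h).derivWithin (uniqueDiffOn_Ici 0 y (hS.subset h.2.2))

lemma hasDerivWithinAt_dT (hf : DifferentiableOn ℝ (unc f) (box X S))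
    (h : (t, x, y) ∈ box X S) :
    HasDerivWithinAt (fun s => f s x y) (dT f t x y) (Ici 0) t :=
  (hasDerivWithinAt_slice_fst hf h).differentiableWithinAt.hasDerivWithinAt

lemma hasDerivWithinAt_dX (hf : DifferentiableOn ℝ (unc f) (box X S))
    (h : (t, x, y) ∈ box X S) :
    HasDerivWithinAt (fun s => f t s y) (dX X f t x y) (Icc 0 X) x :=
  (hasDerivWithinAt_slice_snd hf h).differentiableWithinAt.hasDerivWithinAt

lemma hasDerivWithinAt_dY (hS : RelOpen S) (hf : DifferentiableOn ℝ (unc f) (box X S))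
    (h : (t, x, y) ∈ box X S) :
    HasDerivWithinAt (f t x) (dY f t x y) (Ici 0) y :=
  (hasDerivWithinAt_slice_thd hS hf h).differentiableWithinAt.hasDerivWithinAt

lemma continuousOn_slice (hf : ContinuousOn (unc f) (box X S)) (ht : 0 ≤ t) (hx : x ∈ Icc 0 X) :
    ContinuousOn (f t x) S :=
  hf.comp (f := fun s => (t, x, s)) (by fun_prop) fun _ hs => ⟨ht, hx, hs⟩

variable {n : ℕ}

lemma contDiffOn_fderivWithin_box (hX : 0 < X) (hS : RelOpen S)
    (hf : ContDiffOn ℝ (n + 1 : ℕ) (unc f) (box X S)) (e : ℝ × ℝ × ℝ) :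
    ContDiffOn ℝ n (fun p => fderivWithin ℝ (unc f) (box X S) p e) (box X S) :=
  (hf.fderivWithin (uniqueDiffOn_box hX hS) (by norm_cast)).clm_apply contDiffOn_const

lemma contDiffOn_dT (hX : 0 < X) (hS : RelOpen S)
    (hf : ContDiffOn ℝ (n + 1 : ℕ) (unc f) (box X S)) :
    ContDiffOn ℝ n (unc (dT f)) (box X S) :=
  (contDiffOn_fderivWithin_box hX hS hf (1, 0, 0)).congr fun _ hp =>
    dT_eq (hf.differentiableOn (by norm_cast)) hp

lemma contDiffOn_dX (hX : 0 < X) (hS : RelOpen S)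
    (hf : ContDiffOn ℝ (n + 1 : ℕ) (unc f) (box X S)) :
    ContDiffOn ℝ n (unc (dX X f)) (box X S) :=
  (contDiffOn_fderivWithin_box hX hS hf (0, 1, 0)).congr fun _ hp =>
    dX_eq hX (hf.differentiableOn (by norm_cast)) hp

lemma contDiffOn_dY (hX : 0 < X) (hS : RelOpen S)
    (hf : ContDiffOn ℝ (n + 1 : ℕ) (unc f) (box X S)) :
    ContDiffOn ℝ n (unc (dY f)) (box X S) :=
  (contDiffOn_fderivWithin_box hX hS hf (0, 0, 1)).congr fun _ hp =>
    dY_eq hS (hf.differentiableOn (by norm_cast)) hp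

end Partials

section MaximumPrinciple

lemma deriv_nonneg_of_isMaxOn_Icc {g : ℝ → ℝ} {a c g' : ℝ} (hac : a < c)
    (hg : HasDerivWithinAt g g' (Icc a c) c) (hmax : IsMaxOn g (Icc a c) c) : 0 ≤ g' := by
  have hcone : a - c ∈ posTangentConeAt (Icc a c) c :=
    sub_mem_posTangentConeAt_of_segment_subset (by rw [segment_symm, segment_eq_Icc hac.le])
  have h : (a - c) * g' ≤ 0 := by
    simpa using hmax.localize.hasFDerivWithinAt_nonpos hg.hasFDerivWithinAt hcone
  exact nonneg_of_mul_nonpos_right h (sub_neg.2 hac)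

lemma second_deriv_nonpos_of_isMaxOn_Ico {g g₁ : ℝ → ℝ} {c d g₂ : ℝ} (hcd : c < d)
    (hg : ∀ z ∈ Ico c d, HasDerivWithinAt g (g₁ z) (Ici c) z)
    (hg₁ : HasDerivWithinAt g₁ g₂ (Ici c) c) (h0 : 0 ≤ g₁ c) (hmax : IsMaxOn g (Ico c d) c) :
    g₂ ≤ 0 := by
  by_contra! hpos
  have hg₁pos : ∀ᶠ z in 𝓝[>] c, 0 < g₁ z := by
    have hslope := (hasDerivWithinAt_iff_tendsto_slope' self_notMem_Ioi).1 hg₁.Ioi_of_Ici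
    filter_upwards [hslope.eventually (lt_mem_nhds hpos), self_mem_nhdsWithin] with z hz hcz
    rw [slope_def_field, div_pos_iff_of_pos_right (sub_pos.2 hcz)] at hz
    linarith
  obtain ⟨e, ⟨hce, hed⟩, hsub⟩ := (mem_nhdsGT_iff_exists_mem_Ioc_Ioo_subset hcd).1 hg₁pos
  obtain ⟨z, hcz, hze⟩ := exists_between hce
  have hmem : Icc c z ⊆ Ico c d := fun r hr => ⟨hr.1, hr.2.trans_lt (hze.trans_le hed)⟩
  obtain ⟨r, hr, hslope⟩ := exists_hasDerivAt_eq_slope g g₁ hcz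
    (fun r hr => (hg r (hmem hr)).continuousWithinAt.mono Icc_subset_Ici_self)
    fun r hr => (hg r (hmem (Ioo_subset_Icc_self hr))).hasDerivAt (Ici_mem_nhds hr.1)
  have hle : g z ≤ g c := hmax (hmem (right_mem_Icc.2 hcz.le))
  have : g₁ r ≤ 0 := hslope ▸ div_nonpos_of_nonpos_of_nonneg (sub_nonpos.2 hle)
    (sub_nonneg.2 hcz.le)
  exact this.not_gt (hsub ⟨hr.1, hr.2.trans hze⟩)

lemma exists_isMaxOn_of_tendsto_nonpos {E : Type*} [TopologicalSpace E] {K A : Set E} {f : E → ℝ}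
    (hK : IsCompact K) (hKA : K ⊆ closure A) (hf : ContinuousOn f A)
    (hlim : ∀ x ∈ K \ A, ∃ l ≤ 0, Tendsto f (𝓝[A] x) (𝓝 l)) {p₀ : E} (hp₀ : p₀ ∈ K ∩ A)
    (hpos : 0 < f p₀) : ∃ p ∈ K ∩ A, 0 < f p ∧ IsMaxOn f (K ∩ A) p := by
  have hext : ∀ x ∈ A, extendFrom A f x = f x := fun x hx =>
    extendFrom_eq (subset_closure hx) (hf x hx)
  -- The extension of `f` to `K \ A` is nonpositive there and restores compactness.
  have hcont : ContinuousOn (extendFrom A f) K := by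
    refine continuousOn_extendFrom hKA fun x hx => ?_
    by_cases hxA : x ∈ A
    · exact ⟨f x, hf x hxA⟩
    · obtain ⟨l, -, hl⟩ := hlim x ⟨hx, hxA⟩
      exact ⟨l, hl⟩
  obtain ⟨p, hpK, hmax⟩ := hK.exists_isMaxOn ⟨p₀, hp₀.1⟩ hcont
  have hp : 0 < extendFrom A f p := (hext p₀ hp₀.2 ▸ hpos).trans_le (hmax hp₀.1)
  have hpA : p ∈ A := by
    by_contra hpA
    obtain ⟨l, hl0, hl⟩ := hlim p ⟨hpK, hpA⟩
    rw [extendFrom_eq (hKA hpK) hl] at hp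
    exact hl0.not_gt hp
  refine ⟨p, ⟨hpK, hpA⟩, hext p hpA ▸ hp, fun q hq => ?_⟩
  simpa only [mem_ofPred_eq, hext p hpA, hext q hq.2] using hmax hq.1

/-- The part `{τ = 0} ∪ {ξ = 0}` of the boundary of the Crocco domain, where the initial and inflow
data are prescribed. -/
def parabolicBoundary (X : ℝ) : Set (ℝ × ℝ × ℝ) := {p ∈ croccoDomain X | p.1 = 0 ∨ p.2.1 = 0}

/-- `Wt`, `Wx`, `Wy`, `Wyy` are the derivatives of `W` on the Crocco domain that occur in the
operator `∂_τ + η ∂_ξ - a ∂_η²`, one-sided at the boundary. -/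
structure HasParabolicDerivs (X : ℝ) (W Wt Wx Wy Wyy : ℝ → ℝ → ℝ → ℝ) : Prop where
  time : ∀ ⦃τ ξ η⦄, (τ, ξ, η) ∈ croccoDomain X →
    HasDerivWithinAt (fun s => W s ξ η) (Wt τ ξ η) (Ici 0) τ
  tangential : ∀ ⦃τ ξ η⦄, (τ, ξ, η) ∈ croccoDomain X →
    HasDerivWithinAt (fun s => W τ s η) (Wx τ ξ η) (Icc 0 X) ξ
  normal : ∀ ⦃τ ξ η⦄, (τ, ξ, η) ∈ croccoDomain X →
    HasDerivWithinAt (W τ ξ) (Wy τ ξ η) (Ici 0) η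
  normal_normal : ∀ ⦃τ ξ η⦄, (τ, ξ, η) ∈ croccoDomain X →
    HasDerivWithinAt (Wy τ ξ) (Wyy τ ξ η) (Ici 0) η

variable {X : ℝ} {W Wt Wx Wy Wyy V Vt Vx Vy Vyy : ℝ → ℝ → ℝ → ℝ} {k l : ℝ → ℝ → ℝ}

lemma HasParabolicDerivs.sub (hW : HasParabolicDerivs X W Wt Wx Wy Wyy)
    (hV : HasParabolicDerivs X V Vt Vx Vy Vyy) :
    HasParabolicDerivs X (W - V) (Wt - Vt) (Wx - Vx) (Wy - Vy) (Wyy - Vyy) where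
  time _ _ _ hp := (hW.time hp).sub (hV.time hp)
  tangential _ _ _ hp := (hW.tangential hp).sub (hV.tangential hp)
  normal _ _ _ hp := (hW.normal hp).sub (hV.normal hp)
  normal_normal _ _ _ hp := (hW.normal_normal hp).sub (hV.normal_normal hp)

lemma HasEdgeLimit.sub (hW : HasEdgeLimit X W k) (hV : HasEdgeLimit X V l) :
    HasEdgeLimit X (W - V) (k - l) := fun τ hτ ξ hξ => (hW τ hτ ξ hξ).sub (hV τ hτ ξ hξ)

lemma exists_isMaxOn_of_edge_nonpos (hW : ContinuousOn (unc W) (croccoDomain X))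
    (hedge : HasEdgeLimit X W l) (hl : ∀ τ ≥ 0, ∀ ξ ∈ Icc 0 X, l τ ξ ≤ 0) {p₀ : ℝ × ℝ × ℝ}
    (hp₀ : p₀ ∈ croccoDomain X) (hpos : 0 < unc W p₀) :
    ∃ p ∈ croccoDomain X, p.1 ≤ p₀.1 ∧ 0 < unc W p ∧
      ∀ q ∈ croccoDomain X, q.1 ≤ p₀.1 → unc W q ≤ unc W p := by
  have hclosure : closure (croccoDomain X) = Ici 0 ×ˢ Icc 0 X ×ˢ Icc 0 1 := by
    rw [croccoDomain, closure_prod_eq, closure_prod_eq, closure_Ici, closure_Icc,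
      closure_Ico zero_ne_one]
  obtain ⟨p, hp, hpp, hmax⟩ := exists_isMaxOn_of_tendsto_nonpos
    (K := Icc 0 p₀.1 ×ˢ Icc 0 X ×ˢ Icc 0 1) (isCompact_Icc.prod (isCompact_Icc.prod isCompact_Icc))
    (hclosure ▸ prod_mono Icc_subset_Ici_self subset_rfl) hW
    (by
      rintro ⟨τ, ξ, η⟩ ⟨⟨hτ, hξ, hη⟩, hnot⟩
      obtain rfl : η = 1 := hη.2.eq_of_not_lt fun h => hnot ⟨hτ.1, hξ, hη.1, h⟩
      exact ⟨l τ ξ, hl τ hτ.1 ξ hξ, hedge τ hτ.1 ξ hξ⟩)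
    ⟨⟨⟨hp₀.1, le_rfl⟩, hp₀.2.1, Ico_subset_Icc_self hp₀.2.2⟩, hp₀⟩ hpos
  exact ⟨p, hp.2, hp.1.1.2, hpp, fun q hq hqT =>
    hmax ⟨⟨⟨hq.1, hqT⟩, hq.2.1, Ico_subset_Icc_self hq.2.2⟩, hq⟩⟩

lemma HasParabolicDerivs.signs_of_isMaxOn (hW : HasParabolicDerivs X W Wt Wx Wy Wyy) {τ ξ η : ℝ}
    (hp : (τ, ξ, η) ∈ croccoDomain X) (hτ : τ ≠ 0) (hξ : ξ ≠ 0) (hwall : 0 ≤ Wy τ ξ 0)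
    (hmax : ∀ q ∈ croccoDomain X, q.1 ≤ τ → unc W q ≤ W τ ξ η) :
    0 ≤ Wt τ ξ η ∧ 0 ≤ Wx τ ξ η ∧ Wyy τ ξ η ≤ 0 := by
  obtain ⟨hτ0, hξX, hη : η ∈ Ico 0 1⟩ := id hp
  refine ⟨?_, ?_, ?_⟩
  · exact deriv_nonneg_of_isMaxOn_Icc (hτ0.lt_of_ne' hτ)
      ((hW.time hp).mono Icc_subset_Ici_self) fun s hs => hmax (s, ξ, η) ⟨hs.1, hp.2⟩ hs.2
  · have hsub : Icc 0 ξ ⊆ Icc 0 X := Icc_subset_Icc_right hξX.2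
    exact deriv_nonneg_of_isMaxOn_Icc (hξX.1.lt_of_ne' hξ)
      ((hW.tangential hp).mono hsub) fun s hs => hmax (τ, s, η) ⟨hτ0, hsub hs, hη⟩ le_rfl
  · have hmaxη : ∀ z ∈ Ico 0 1, W τ ξ z ≤ W τ ξ η :=
      fun z hz => hmax (τ, ξ, z) ⟨hτ0, hξX, hz⟩ le_rfl
    have hWyη : 0 ≤ Wy τ ξ η := by
      rcases eq_or_lt_of_le hη.1 with rfl | hη0
      · exact hwall
      · exact deriv_nonneg_of_isMaxOn_Icc hη0 ((hW.normal hp).mono Icc_subset_Ici_self)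
          fun z hz => hmaxη z ⟨hz.1, hz.2.trans_lt hη.2⟩
    have hsub : Ici η ⊆ Ici 0 := Ici_subset_Ici.2 hη.1
    have hWy : ∀ z ∈ Ico η 1, HasDerivWithinAt (W τ ξ) (Wy τ ξ z) (Ici η) z := fun z hz =>
      (hW.normal (η := z) ⟨hτ0, hξX, hη.1.trans hz.1, hz.2⟩).mono hsub
    exact second_deriv_nonpos_of_isMaxOn_Ico hη.2 hWy
      ((hW.normal_normal hp).mono hsub) hWyη fun z hz => hmaxη z ⟨hη.1.trans hz.1, hz.2⟩

theorem max_principle (hd : HasParabolicDerivs X W Wt Wx Wy Wyy)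
    (hW : ContinuousOn (unc W) (croccoDomain X)) (hedge : HasEdgeLimit X W l)
    (hl : ∀ τ ≥ 0, ∀ ξ ∈ Icc 0 X, l τ ξ ≤ 0) (hdata : ∀ p ∈ parabolicBoundary X, unc W p ≤ 0)
    (hwall : ∀ τ ≥ 0, ∀ ξ ∈ Icc 0 X, 0 ≤ Wy τ ξ 0)
    (hpde : ∀ τ ξ η, (τ, ξ, η) ∈ croccoDomain X → 0 < W τ ξ η →
      ∃ a ≥ 0, Wt τ ξ η + η * Wx τ ξ η ≤ a * Wyy τ ξ η) :
    ∀ p ∈ croccoDomain X, unc W p ≤ 0 := by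
  intro p₀ hp₀
  by_contra! hpos
  -- `W - ε τ` is still positive at `p₀`, and turns the differential inequality into a strict one.
  obtain ⟨ε, hε, hεp₀⟩ : ∃ ε > 0, p₀.1 * ε < unc W p₀ := exists_pos_mul_lt hpos _
  let Z : ℝ → ℝ → ℝ → ℝ := W - fun τ _ _ => τ * ε
  have hZd : HasParabolicDerivs X Z (Wt - fun _ _ _ => ε) (Wx - 0) (Wy - 0) (Wyy - 0) :=
    hd.sub ⟨fun τ _ _ _ => by simpa using (hasDerivWithinAt_id τ _).mul_const ε,
      fun _ ξ _ _ => hasDerivWithinAt_const ξ _ _, fun _ _ η _ => hasDerivWithinAt_const η _ _,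
      fun _ _ η _ => hasDerivWithinAt_const η _ _⟩
  have hZedge : HasEdgeLimit X Z (l - fun τ _ => τ * ε) := hedge.sub fun τ _ ξ _ =>
    tendsto_nhdsWithin_of_tendsto_nhds
      (Continuous.tendsto (f := fun p : ℝ × ℝ × ℝ => p.1 * ε) (by fun_prop) (τ, ξ, 1))
  obtain ⟨⟨τ, ξ, η⟩, hp, hle, hZpos, hmax⟩ := exists_isMaxOn_of_edge_nonpos (W := Z)
    (hW.sub (by fun_prop : ContinuousOn (fun p : ℝ × ℝ × ℝ => p.1 * ε) (croccoDomain X))) hZedge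
    (fun τ hτ ξ hξ => sub_nonpos.2 ((hl τ hτ ξ hξ).trans (mul_nonneg hτ hε.le)))
    hp₀ (sub_pos.2 hεp₀)
  have hWpos : 0 < W τ ξ η :=
    hZpos.trans_le (sub_le_self _ (mul_nonneg hp.1 hε.le))
  have hbdry : ¬(τ = 0 ∨ ξ = 0) := fun h => (hdata _ ⟨hp, h⟩).not_gt hWpos
  push Not at hbdry
  obtain ⟨ht, hx, hyy⟩ := hZd.signs_of_isMaxOn hp hbdry.1 hbdry.2
    (by simpa using hwall τ hp.1 ξ hp.2.1) fun q hq hqτ => hmax q hq (hqτ.trans hle)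
  obtain ⟨a, ha, hpdeτ⟩ := hpde τ ξ η hp hWpos
  simp only [Pi.sub_apply, Pi.zero_apply, sub_zero] at ht hx hyy
  linarith [mul_nonneg hp.2.2.1 hx, mul_nonpos_of_nonneg_of_nonpos ha hyy]

end MaximumPrinciple

section CroccoTransform

lemma fderiv_fderiv_apply_comm {E : Type*} [NormedAddCommGroup E] [NormedSpace ℝ E] {f : E → ℝ}
    {p : E} (hf : ContDiffAt ℝ 2 f p) (a b : E) :
    fderiv ℝ (fun q => fderiv ℝ f q a) p b = fderiv ℝ (fun q => fderiv ℝ f q b) p a := by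
  have hf' : DifferentiableAt ℝ (fderiv ℝ f) p :=
    (hf.fderiv_right (m := 1) (by norm_num)).differentiableAt (by norm_num)
  have hsnd (c d : E) : fderiv ℝ (fun q => fderiv ℝ f q c) p d = fderiv ℝ (fderiv ℝ f) p d c := by
    simp [(hf'.hasFDerivAt.clm_apply (hasFDerivAt_const c p)).fderiv]
  rw [hsnd, hsnd, (hf.isSymmSndFDerivAt (by simp)).eq]

lemma continuousLinearMap_apply_triple (L : ℝ × ℝ × ℝ →L[ℝ] ℝ) (a b c : ℝ) :
    L (a, b, c) = a * L (1, 0, 0) + b * L (0, 1, 0) + c * L (0, 0, 1) := by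
  have h : ((a, b, c) : ℝ × ℝ × ℝ) = a • (1, 0, 0) + b • (0, 1, 0) + c • (0, 0, 1) := by simp
  rw [h, map_add, map_add, map_smul, map_smul, map_smul, smul_eq_mul, smul_eq_mul, smul_eq_mul]

/-- The Crocco change of variables `(t, x, y) ↦ (t, x, f (t, x, y))`. -/
def croccoMap (f : ℝ × ℝ × ℝ → ℝ) (p : ℝ × ℝ × ℝ) : ℝ × ℝ × ℝ := (p.1, p.2.1, f p)

lemma hasDerivAt_vertical_line (t x y : ℝ) :
    HasDerivAt (fun s : ℝ => ((t, x, s) : ℝ × ℝ × ℝ)) (0, 0, 1) y :=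
  (hasDerivAt_const y t).prodMk ((hasDerivAt_const y x).prodMk (hasDerivAt_id y))

variable {f g : ℝ × ℝ × ℝ → ℝ} {p : ℝ × ℝ × ℝ} {v : ℝ → ℝ} {t x y : ℝ}

lemma hasFDerivAt_croccoMap (hf : DifferentiableAt ℝ f p) :
    HasFDerivAt (croccoMap f) ((ContinuousLinearMap.fst ℝ ℝ (ℝ × ℝ)).prod
      ((ContinuousLinearMap.fst ℝ ℝ ℝ ∘L ContinuousLinearMap.snd ℝ ℝ (ℝ × ℝ)).prod
        (fderiv ℝ f p))) p :=
  hasFDerivAt_fst.prodMk ((hasFDerivAt_fst.comp p hasFDerivAt_snd).prodMk hf.hasFDerivAt)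

lemma fderiv_normal_deriv_eq (hf : DifferentiableAt ℝ f p)
    (hg : DifferentiableAt ℝ g (croccoMap f p))
    (hcr : ∀ᶠ q in 𝓝 p, g (croccoMap f q) = fderiv ℝ f q (0, 0, 1)) (e : ℝ × ℝ × ℝ) :
    fderiv ℝ (fun q => fderiv ℝ f q (0, 0, 1)) p e
      = fderiv ℝ g (croccoMap f p) (e.1, e.2.1, fderiv ℝ f p e) := by
  have heq : (fun q => fderiv ℝ f q (0, 0, 1)) =ᶠ[𝓝 p] g ∘ croccoMap f := by
    filter_upwards [hcr] with q hq using hq.symm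
  rw [heq.fderiv_eq, (hg.hasFDerivAt.comp p (hasFDerivAt_croccoMap hf)).fderiv]
  rfl

lemma hasDerivAt_fderiv_vertical_line (hf : ContDiffAt ℝ 2 f (t, x, y))
    (hg : DifferentiableAt ℝ g (croccoMap f (t, x, y)))
    (hcr : ∀ᶠ q in 𝓝 (t, x, y), g (croccoMap f q) = fderiv ℝ f q (0, 0, 1)) (e : ℝ × ℝ × ℝ) :
    HasDerivAt (fun s => fderiv ℝ f (t, x, s) e)
      (fderiv ℝ g (croccoMap f (t, x, y)) (e.1, e.2.1, fderiv ℝ f (t, x, y) e)) y := by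
  have hf' : DifferentiableAt ℝ (fun q => fderiv ℝ f q e) (t, x, y) :=
    ((hf.fderiv_right (m := 1) (by norm_num)).differentiableAt (by norm_num)).clm_apply
      (differentiableAt_const e)
  have h := hf'.hasFDerivAt.comp_hasDerivAt y (hasDerivAt_vertical_line t x y)
  rwa [fderiv_fderiv_apply_comm hf,
    fderiv_normal_deriv_eq (hf.differentiableAt (by norm_num)) hg hcr] at h

lemma hasDerivAt_normal_deriv_comp_croccoMap (hf : DifferentiableAt ℝ f (t, x, y))
    (hg : ContDiffAt ℝ 2 g (croccoMap f (t, x, y))) :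
    HasDerivAt (fun s => fderiv ℝ g (croccoMap f (t, x, s)) (0, 0, 1))
      (fderiv ℝ f (t, x, y) (0, 0, 1)
        * fderiv ℝ (fun q => fderiv ℝ g q (0, 0, 1)) (croccoMap f (t, x, y)) (0, 0, 1)) y := by
  have hg' : DifferentiableAt ℝ (fun q => fderiv ℝ g q (0, 0, 1)) (croccoMap f (t, x, y)) :=
    ((hg.fderiv_right (m := 1) (by norm_num)).differentiableAt (by norm_num)).clm_apply
      (differentiableAt_const _)
  have hline : HasDerivAt (fun s => croccoMap f (t, x, s)) (0, 0, fderiv ℝ f (t, x, y) (0, 0, 1))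
      y := (hasDerivAt_const y t).prodMk ((hasDerivAt_const y x).prodMk
        (hf.hasFDerivAt.comp_hasDerivAt y (hasDerivAt_vertical_line t x y)))
  have h := hg'.hasFDerivAt.comp_hasDerivAt y hline
  rwa [continuousLinearMap_apply_triple _ 0 0, zero_mul, zero_mul, zero_add, zero_add] at h

-- Differentiate `∂_y² f = ∂_t f + f ∂_x f + v ∂_y f` in `y`, writing `∂_y f` as `g ∘ croccoMap f`.
lemma crocco_pde_of_momentum (hf : ContDiffAt ℝ 2 f (t, x, y))
    (hg : ContDiffAt ℝ 2 g (croccoMap f (t, x, y)))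
    (hcr : ∀ᶠ p in 𝓝 (t, x, y), g (croccoMap f p) = fderiv ℝ f p (0, 0, 1))
    (hv : HasDerivAt v (-fderiv ℝ f (t, x, y) (0, 1, 0)) y)
    (hmom : ∀ᶠ s in 𝓝 y, fderiv ℝ f (t, x, s) (1, 0, 0)
      + f (t, x, s) * fderiv ℝ f (t, x, s) (0, 1, 0) + v s * fderiv ℝ f (t, x, s) (0, 0, 1)
      - fderiv ℝ (fun p => fderiv ℝ f p (0, 0, 1)) (t, x, s) (0, 0, 1) = 0) :
    fderiv ℝ g (croccoMap f (t, x, y)) (1, 0, 0)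
      + f (t, x, y) * fderiv ℝ g (croccoMap f (t, x, y)) (0, 1, 0)
      = g (croccoMap f (t, x, y)) ^ 2
        * fderiv ℝ (fun q => fderiv ℝ g q (0, 0, 1)) (croccoMap f (t, x, y)) (0, 0, 1) := by
  have hf₁ : ∀ᶠ p in 𝓝 (t, x, y), DifferentiableAt ℝ f p := by
    filter_upwards [hf.eventually (by simp)] with p hp using hp.differentiableAt (by norm_num)
  have hg₁ : ∀ᶠ p in 𝓝 (t, x, y), DifferentiableAt ℝ g (croccoMap f p) :=
    (hasFDerivAt_croccoMap hf₁.self_of_nhds).continuousAt.eventually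
      (hg.eventually (by simp) |>.mono fun q hq => hq.differentiableAt (by norm_num))
  have hline := hasDerivAt_vertical_line t x y
  have hfyy : ∀ᶠ s in 𝓝 y, fderiv ℝ (fun p => fderiv ℝ f p (0, 0, 1)) (t, x, s) (0, 0, 1)
      = fderiv ℝ f (t, x, s) (0, 0, 1) * fderiv ℝ g (croccoMap f (t, x, s)) (0, 0, 1) := by
    filter_upwards [hline.continuousAt.eventually hf₁, hline.continuousAt.eventually hg₁,
      hline.continuousAt.eventually hcr.eventually_nhds] with s h₁ h₂ h₃
    rw [fderiv_normal_deriv_eq h₁ h₂ h₃, continuousLinearMap_apply_triple _ _ _ (fderiv ℝ f _ _),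
      zero_mul, zero_mul, zero_add, zero_add]
  have hmom' : (fun s => fderiv ℝ f (t, x, s) (0, 0, 1)
        * fderiv ℝ g (croccoMap f (t, x, s)) (0, 0, 1)) =ᶠ[𝓝 y]
      fun s => fderiv ℝ f (t, x, s) (1, 0, 0) + f (t, x, s) * fderiv ℝ f (t, x, s) (0, 1, 0)
        + v s * fderiv ℝ f (t, x, s) (0, 0, 1) := by
    filter_upwards [hfyy, hmom] with s h₁ h₂
    linear_combination -h₁ - h₂
  have hdir := hasDerivAt_fderiv_vertical_line hf hg₁.self_of_nhds hcr
  have hfy : HasDerivAt (fun s => f (t, x, s)) (fderiv ℝ f (t, x, y) (0, 0, 1)) y :=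
    hf₁.self_of_nhds.hasFDerivAt.comp_hasDerivAt y hline
  have hderiv := (((hdir (1, 0, 0)).add (hfy.mul (hdir (0, 1, 0)))).add
    (hv.mul (hdir (0, 0, 1)))).congr_of_eventuallyEq hmom' |>.unique
    ((hdir (0, 0, 1)).mul (hasDerivAt_normal_deriv_comp_croccoMap hf₁.self_of_nhds hg))
  simp only [continuousLinearMap_apply_triple (fderiv ℝ g _) _ _ (fderiv ℝ f _ _)] at hderiv
  rw [hcr.self_of_nhds]
  linear_combination hderiv + fderiv ℝ g (croccoMap f (t, x, y)) (0, 0, 1) * hmom'.self_of_nhds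

end CroccoTransform

section Interior

variable {X : ℝ} {S : Set ℝ} {f : ℝ → ℝ → ℝ → ℝ} {t x y : ℝ}

lemma box_mem_nhds (ht : 0 < t) (hx : x ∈ Ioo 0 X) (hy : S ∈ 𝓝 y) : box X S ∈ 𝓝 (t, x, y) :=
  prod_mem_nhds (Ici_mem_nhds ht) (prod_mem_nhds (Icc_mem_nhds hx.1 hx.2) hy)

lemma dT_eq_fderiv (hf : DifferentiableOn ℝ (unc f) (box X S)) (h : box X S ∈ 𝓝 (t, x, y)) :
    dT f t x y = fderiv ℝ (unc f) (t, x, y) (1, 0, 0) := by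
  rw [dT_eq hf (mem_of_mem_nhds h), fderivWithin_of_mem_nhds h]

lemma dX_eq_fderiv (hX : 0 < X) (hf : DifferentiableOn ℝ (unc f) (box X S))
    (h : box X S ∈ 𝓝 (t, x, y)) : dX X f t x y = fderiv ℝ (unc f) (t, x, y) (0, 1, 0) := by
  rw [dX_eq hX hf (mem_of_mem_nhds h), fderivWithin_of_mem_nhds h]

lemma dY_eq_fderiv (hS : RelOpen S) (hf : DifferentiableOn ℝ (unc f) (box X S))
    (h : box X S ∈ 𝓝 (t, x, y)) : dY f t x y = fderiv ℝ (unc f) (t, x, y) (0, 0, 1) := by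
  rw [dY_eq hS hf (mem_of_mem_nhds h), fderivWithin_of_mem_nhds h]

lemma dYY_eq_fderiv (hX : 0 < X) (hS : RelOpen S) (hf : ContDiffOn ℝ (2 : ℕ) (unc f) (box X S))
    (h : box X S ∈ 𝓝 (t, x, y)) :
    dYY f t x y = fderiv ℝ (fun p => fderiv ℝ (unc f) p (0, 0, 1)) (t, x, y) (0, 0, 1) := by
  have hdY := (contDiffOn_dY (n := 1) hX hS hf).differentiableOn (by norm_num)
  have heq : unc (dY f) =ᶠ[𝓝 (t, x, y)] fun p => fderiv ℝ (unc f) p (0, 0, 1) := by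
    filter_upwards [eventually_mem_nhds_iff.2 h] with p hp
      using dY_eq_fderiv hS (hf.differentiableOn (by norm_num)) hp
  rw [dYY, dY_eq_fderiv hS hdY h, heq.fderiv_eq]

end Interior

/-- `u` is a monotone solution of the Prandtl equation on `[0, X]` with Crocco transform `w`, where
of the regularity of an Oleinik solution only `w ∈ C²` and `w → 0` as `η → 1` are retained. -/
structure IsMonotoneSolution (X : ℝ) (u w : ℝ → ℝ → ℝ → ℝ) : Prop where
  prandtl : ∃ v, IsPrandtlSolution X u v
  monotone : ∀ t ≥ 0, ∀ x ∈ Icc 0 X, ∀ y ≥ 0, 0 < dY u t x y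
  crocco : ∀ t ≥ 0, ∀ x ∈ Icc 0 X, ∀ y ≥ 0, w t x (u t x y) = dY u t x y
  contDiffOn_w : ContDiffOn ℝ (2 : ℕ) (unc w) (croccoDomain X)
  edge_w : HasEdgeLimit X w (fun _ _ => 0)

lemma IsOleinikSolution.isMonotoneSolution {X : ℝ} {u w : ℝ → ℝ → ℝ → ℝ}
    (h : IsOleinikSolution X u w) : IsMonotoneSolution X u w :=
  ⟨h.prandtl, h.monotone, h.crocco, h.contDiffOn_two, h.edge_w⟩

namespace IsMonotoneSolution

variable {X : ℝ} {u w : ℝ → ℝ → ℝ → ℝ} {t x y η : ℝ}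

lemma contDiffOn_u (h : IsMonotoneSolution X u w) :
    ContDiffOn ℝ (2 : ℕ) (unc u) (box X (Ici 0)) := h.prandtl.choose_spec.contDiffOn_u

lemma differentiableOn_u (h : IsMonotoneSolution X u w) :
    DifferentiableOn ℝ (unc u) (box X (Ici 0)) := h.contDiffOn_u.differentiableOn (by norm_num)

lemma differentiableOn_w (h : IsMonotoneSolution X u w) :
    DifferentiableOn ℝ (unc w) (box X (Ico 0 1)) := h.contDiffOn_w.differentiableOn (by norm_num)

lemma continuousOn_w (h : IsMonotoneSolution X u w) :
    ContinuousOn (unc w) (croccoDomain X) := h.contDiffOn_w.continuousOn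

lemma u_wall (h : IsMonotoneSolution X u w) (ht : 0 ≤ t) (hx : x ∈ Icc 0 X) : u t x 0 = 0 :=
  h.prandtl.choose_spec.u_wall t ht x hx

lemma u_far (h : IsMonotoneSolution X u w) (ht : 0 ≤ t) (hx : x ∈ Icc 0 X) :
    Tendsto (u t x) atTop (𝓝 1) := h.prandtl.choose_spec.u_far t ht x hx

lemma hasDerivWithinAt_u (h : IsMonotoneSolution X u w) (ht : 0 ≤ t) (hx : x ∈ Icc 0 X)
    (hy : 0 ≤ y) : HasDerivWithinAt (u t x) (dY u t x y) (Ici 0) y :=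
  hasDerivWithinAt_dY relOpen_Ici h.differentiableOn_u ⟨ht, hx, hy⟩

lemma continuousOn_u_slice (h : IsMonotoneSolution X u w) (ht : 0 ≤ t) (hx : x ∈ Icc 0 X) :
    ContinuousOn (u t x) (Ici 0) := fun _ hy => (h.hasDerivWithinAt_u ht hx hy).continuousWithinAt

lemma continuousOn_w_slice (h : IsMonotoneSolution X u w) (ht : 0 ≤ t) (hx : x ∈ Icc 0 X) :
    ContinuousOn (w t x) (Ico 0 1) := continuousOn_slice h.continuousOn_w ht hx

lemma strictMonoOn_u (h : IsMonotoneSolution X u w) (ht : 0 ≤ t) (hx : x ∈ Icc 0 X) :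
    StrictMonoOn (u t x) (Ici 0) := by
  refine strictMonoOn_of_deriv_pos (convex_Ici 0) (h.continuousOn_u_slice ht hx) fun z hz => ?_
  rw [interior_Ici, mem_Ioi] at hz
  rw [((h.hasDerivWithinAt_u ht hx hz.le).hasDerivAt (Ici_mem_nhds hz)).deriv]
  exact h.monotone t ht x hx z hz.le

lemma u_mem (h : IsMonotoneSolution X u w) (ht : 0 ≤ t) (hx : x ∈ Icc 0 X) (hy : 0 ≤ y) :
    u t x y ∈ Ico (0 : ℝ) 1 := by
  have hmono := h.strictMonoOn_u ht hx
  refine ⟨h.u_wall ht hx ▸ hmono.monotoneOn self_mem_Ici hy hy, ?_⟩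
  have hy1 : 0 ≤ y + 1 := by positivity
  refine (hmono hy hy1 (lt_add_one y)).trans_le (ge_of_tendsto (h.u_far ht hx) ?_)
  filter_upwards [eventually_ge_atTop (y + 1)] with z hz
    using hmono.monotoneOn hy1 (hy1.trans hz) hz

lemma exists_u_eq (h : IsMonotoneSolution X u w) (ht : 0 ≤ t) (hx : x ∈ Icc 0 X)
    (hη : η ∈ Ico (0 : ℝ) 1) : ∃ y ≥ 0, u t x y = η := by
  obtain ⟨z, hz, hz0⟩ := (((h.u_far ht hx).eventually (lt_mem_nhds hη.2)).and
    (eventually_ge_atTop 0)).exists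
  obtain ⟨y, hy, hyη⟩ := intermediate_value_Icc hz0
    ((h.continuousOn_u_slice ht hx).mono Icc_subset_Ici_self)
    (show η ∈ Icc (u t x 0) (u t x z) from ⟨(h.u_wall ht hx).trans_le hη.1, hz.le⟩)
  exact ⟨y, hy.1, hyη⟩

lemma w_pos (h : IsMonotoneSolution X u w) (ht : 0 ≤ t) (hx : x ∈ Icc 0 X)
    (hη : η ∈ Ico (0 : ℝ) 1) : 0 < w t x η := by
  obtain ⟨y, hy, rfl⟩ := h.exists_u_eq ht hx hη
  exact h.crocco t ht x hx y hy ▸ h.monotone t ht x hx y hy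

lemma contDiffOn_dY_w (hX : 0 < X) (h : IsMonotoneSolution X u w) :
    ContDiffOn ℝ (1 : ℕ) (unc (dY w)) (box X (Ico 0 1)) :=
  contDiffOn_dY hX relOpen_Ico h.contDiffOn_w

lemma continuousOn_dYY_w (hX : 0 < X) (h : IsMonotoneSolution X u w) :
    ContinuousOn (unc (dYY w)) (box X (Ico 0 1)) :=
  (contDiffOn_dY (n := 0) hX relOpen_Ico (h.contDiffOn_dY_w hX)).continuousOn

lemma hasParabolicDerivs (hX : 0 < X) (h : IsMonotoneSolution X u w) :
    HasParabolicDerivs X w (dT w) (dX X w) (dY w) (dYY w) where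
  time _ _ _ hp := hasDerivWithinAt_dT h.differentiableOn_w hp
  tangential _ _ _ hp := hasDerivWithinAt_dX h.differentiableOn_w hp
  normal _ _ _ hp := hasDerivWithinAt_dY relOpen_Ico h.differentiableOn_w hp
  normal_normal _ _ _ hp := hasDerivWithinAt_dY relOpen_Ico
    ((h.contDiffOn_dY_w hX).differentiableOn (by norm_num)) hp

lemma crocco_equation_of_interior (hX : 0 < X) (h : IsMonotoneSolution X u w) (ht : 0 < t)
    (hx : x ∈ Ioo 0 X) (hη : η ∈ Ioo (0 : ℝ) 1) :
    dT w t x η + η * dX X w t x η = w t x η ^ 2 * dYY w t x η := by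
  have hxIcc := Ioo_subset_Icc_self hx
  obtain ⟨y, hy, rfl⟩ := h.exists_u_eq ht.le hxIcc (Ioo_subset_Ico_self hη)
  have hy0 : 0 < y := hy.lt_of_ne' <| by
    rintro rfl
    exact hη.1.ne' (h.u_wall ht.le hxIcc)
  obtain ⟨v, hv⟩ := h.prandtl
  have hphys {s : ℝ} (hs : 0 < s) : box X (Ici 0) ∈ 𝓝 (t, x, s) :=
    box_mem_nhds ht hx (Ici_mem_nhds hs)
  have hcrocco : box X (Ico 0 1) ∈ 𝓝 (t, x, u t x y) :=
    box_mem_nhds ht hx (Ico_mem_nhds hη.1 hη.2)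
  rw [dT_eq_fderiv h.differentiableOn_w hcrocco, dX_eq_fderiv hX h.differentiableOn_w hcrocco,
    dYY_eq_fderiv hX relOpen_Ico h.contDiffOn_w hcrocco]
  refine crocco_pde_of_momentum (f := unc u) (v := v t x) (y := y)
    (h.contDiffOn_u.contDiffAt (hphys hy0)) (h.contDiffOn_w.contDiffAt hcrocco) ?_ ?_ ?_
  · filter_upwards [eventually_mem_nhds_iff.2 (hphys hy0)] with p hp
    obtain ⟨hpt, hpx, hpy⟩ := mem_of_mem_nhds hp
    rw [← dY_eq_fderiv relOpen_Ici h.differentiableOn_u hp]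
    exact h.crocco _ hpt _ hpx _ hpy
  · rw [← dX_eq_fderiv hX h.differentiableOn_u (hphys hy0)]
    exact hv.divergence t ht x (Ioo_subset_Ioc_self hx) y hy0
  · filter_upwards [lt_mem_nhds hy0] with s hs
    rw [← dT_eq_fderiv h.differentiableOn_u (hphys hs),
      ← dX_eq_fderiv hX h.differentiableOn_u (hphys hs),
      ← dY_eq_fderiv relOpen_Ici h.differentiableOn_u (hphys hs),
      ← dYY_eq_fderiv hX relOpen_Ici h.contDiffOn_u (hphys hs)]
    exact hv.momentum t ht x (Ioo_subset_Ioc_self hx) s hs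

theorem crocco_equation (hX : 0 < X) (h : IsMonotoneSolution X u w)
    (hp : (t, x, η) ∈ croccoDomain X) :
    dT w t x η + η * dX X w t x η = w t x η ^ 2 * dYY w t x η := by
  have hT := (contDiffOn_dT (n := 1) hX relOpen_Ico h.contDiffOn_w).continuousOn
  have hXc := (contDiffOn_dX (n := 1) hX relOpen_Ico h.contDiffOn_w).continuousOn
  have hclosure : croccoDomain X ⊆ closure (Ioi 0 ×ˢ Ioo 0 X ×ˢ Ioo 0 1) := by
    rw [closure_prod_eq, closure_prod_eq, closure_Ioi, closure_Ioo hX.ne, closure_Ioo zero_ne_one]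
    exact prod_mono subset_rfl (prod_mono subset_rfl Ico_subset_Icc_self)
  exact EqOn.of_subset_closure
    (fun q hq => h.crocco_equation_of_interior hX hq.1 hq.2.1 hq.2.2)
    (hT.add (continuous_snd.snd.continuousOn.mul hXc))
    ((h.continuousOn_w.pow 2).mul (h.continuousOn_dYY_w hX))
    (prod_mono Ioi_subset_Ici_self (prod_mono Ioo_subset_Icc_self Ioo_subset_Ico_self))
    hclosure hp

lemma hasDerivWithinAt_dY_u (h : IsMonotoneSolution X u w) (ht : 0 ≤ t)
    (hx : x ∈ Icc 0 X) (hy : 0 ≤ y) :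
    HasDerivWithinAt (dY u t x) (dY w t x (u t x y) * dY u t x y) (Ici 0) y := by
  have hw : HasDerivWithinAt (w t x) (dY w t x (u t x y)) (Ici 0) (u t x y) :=
    hasDerivWithinAt_dY relOpen_Ico h.differentiableOn_w ⟨ht, hx, h.u_mem ht hx hy⟩
  exact (hw.comp y (h.hasDerivWithinAt_u ht hx hy) fun z hz => (h.u_mem ht hx hz).1).congr
    (fun z hz => (h.crocco t ht x hx z hz).symm) (h.crocco t ht x hx y hy).symm

lemma dYY_u_wall (hX : 0 < X) (h : IsMonotoneSolution X u w) (ht : 0 < t) (hx : x ∈ Ioc 0 X) :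
    dYY u t x 0 = 0 := by
  have hxIcc := Ioc_subset_Icc_self hx
  obtain ⟨v, hv⟩ := h.prandtl
  have hdY := contDiffOn_dY (n := 1) hX relOpen_Ici h.contDiffOn_u
  have hdTc := continuousOn_slice
    (contDiffOn_dT (n := 1) hX relOpen_Ici h.contDiffOn_u).continuousOn ht.le hxIcc
  have hdXc := continuousOn_slice
    (contDiffOn_dX (n := 1) hX relOpen_Ici h.contDiffOn_u).continuousOn ht.le hxIcc
  have hdYc := continuousOn_slice hdY.continuousOn ht.le hxIcc
  have hdYYc := continuousOn_slice
    (contDiffOn_dY (n := 0) hX relOpen_Ici hdY).continuousOn ht.le hxIcc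
  have hmom : dT u t x 0 + u t x 0 * dX X u t x 0 + v t x 0 * dY u t x 0 - dYY u t x 0 = 0 :=
    EqOn.of_subset_closure (s := Ioi 0) (fun y hy => hv.momentum t ht x hx y hy)
      (((hdTc.add ((h.continuousOn_u_slice ht.le hxIcc).mul hdXc)).add
        ((hv.continuousOn_v t ht x hx).mul hdYc)).sub hdYYc)
      continuousOn_const Ioi_subset_Ici_self (closure_Ioi (0 : ℝ)).ge self_mem_Ici
  have hdT : dT u t x 0 = 0 := by
    have hwall : EqOn (fun s => u s x 0) (fun _ => 0) (Ici 0) := fun s hs => h.u_wall hs hxIcc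
    rw [dT, derivWithin_congr hwall (hwall ht.le)]
    simp
  rw [hdT, h.u_wall ht.le hxIcc, hv.v_wall t ht x hx] at hmom
  linarith

theorem dY_w_wall (hX : 0 < X) (h : IsMonotoneSolution X u w) (ht : 0 ≤ t)
    (hx : x ∈ Icc 0 X) : dY w t x 0 = 0 := by
  have hinterior : ∀ p ∈ Ioi 0 ×ˢ Ioc 0 X, dY w p.1 p.2 0 = 0 := by
    rintro ⟨t, x⟩ ⟨ht : 0 < t, hx : x ∈ Ioc 0 X⟩
    have hxIcc := Ioc_subset_Icc_self hx
    have hdYY : dYY u t x 0 = dY w t x 0 * dY u t x 0 := by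
      have := (h.hasDerivWithinAt_dY_u ht.le hxIcc le_rfl).derivWithin
        (uniqueDiffOn_Ici 0 _ self_mem_Ici)
      rwa [h.u_wall ht.le hxIcc] at this
    rw [h.dYY_u_wall hX ht hx] at hdYY
    exact (mul_eq_zero.1 hdYY.symm).resolve_right (h.monotone t ht.le x hxIcc 0 le_rfl).ne'
  have hcont : ContinuousOn (fun p : ℝ × ℝ => dY w p.1 p.2 0) (Ici 0 ×ˢ Icc 0 X) :=
    (h.contDiffOn_dY_w hX).continuousOn.comp (f := fun p : ℝ × ℝ => (p.1, p.2, (0 : ℝ)))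
      (by fun_prop) fun p hp => ⟨hp.1, hp.2, left_mem_Ico.2 one_pos⟩
  have hclosure : Ici (0 : ℝ) ×ˢ Icc 0 X ⊆ closure (Ioi (0 : ℝ) ×ˢ Ioc 0 X) := by
    rw [closure_prod_eq, closure_Ioi, closure_Ioc hX.ne]
  exact EqOn.of_subset_closure hinterior hcont continuousOn_const
    (prod_mono Ioi_subset_Ici_self Ioc_subset_Icc_self) hclosure
    (show (t, x) ∈ Ici (0 : ℝ) ×ˢ Icc 0 X from ⟨ht, hx⟩)

end IsMonotoneSolution

section Comparison

/-- `g` is a nonnegative concave function on `[0, 1)` with derivatives `g₁`, `g₂`, nonincreasing at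
the wall `η = 0` and continuous up to the edge `η = 1`: the `η`-dependence of a barrier. -/
structure ConcaveProfile (g g₁ g₂ : ℝ → ℝ) : Prop where
  nonneg : ∀ η ∈ Icc (0 : ℝ) 1, 0 ≤ g η
  edge : ContinuousWithinAt g (Ico 0 1) 1
  hasDerivAt : ∀ η ∈ Ico (0 : ℝ) 1, HasDerivAt g (g₁ η) η
  hasDerivAt_deriv : ∀ η ∈ Ico (0 : ℝ) 1, HasDerivAt g₁ (g₂ η) η
  wall : g₁ 0 ≤ 0
  concave : ∀ η ∈ Ico (0 : ℝ) 1, g₂ η ≤ 0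

/-- The barrier `A e^{-(κ τ + β ξ)} g(η)`. -/
def dampedProfile (A κ β : ℝ) (g : ℝ → ℝ) (τ ξ η : ℝ) : ℝ := A * Real.exp (-(κ * τ + β * ξ)) * g η

variable {X A κ β : ℝ} {g g₁ g₂ : ℝ → ℝ}

lemma hasDerivAt_exp_neg_mul_add (κ c s : ℝ) :
    HasDerivAt (fun s => Real.exp (-(κ * s + c))) (-κ * Real.exp (-(κ * s + c))) s := by
  have h : HasDerivAt (fun s => -(κ * s + c)) (-κ) s :=
    (((hasDerivAt_id s).const_mul κ).add_const c).neg.congr_deriv (by rw [mul_one])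
  exact h.exp.congr_deriv (mul_comm _ _)

namespace ConcaveProfile

lemma hasParabolicDerivs (hg : ConcaveProfile g g₁ g₂) (A κ β : ℝ) :
    HasParabolicDerivs X (dampedProfile A κ β g) (dampedProfile (-κ * A) κ β g)
      (dampedProfile (-β * A) κ β g) (dampedProfile A κ β g₁) (dampedProfile A κ β g₂) where
  time τ ξ η _ :=
    ((((hasDerivAt_exp_neg_mul_add κ (β * ξ) τ).const_mul A).mul_const (g η)).congr_deriv
      (by rw [dampedProfile]; ring)).hasDerivWithinAt
  tangential τ ξ η _ := by
    have h := ((hasDerivAt_exp_neg_mul_add β (κ * τ) ξ).const_mul A).mul_const (g η)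
    simp only [add_comm (β * _)] at h
    exact (h.congr_deriv (by rw [dampedProfile]; ring)).hasDerivWithinAt
  normal _ _ _ hp := ((hg.hasDerivAt _ hp.2.2).const_mul _).hasDerivWithinAt
  normal_normal _ _ _ hp := ((hg.hasDerivAt_deriv _ hp.2.2).const_mul _).hasDerivWithinAt

lemma continuousOn_dampedProfile (hg : ConcaveProfile g g₁ g₂) (A κ β : ℝ) :
    ContinuousOn (unc (dampedProfile A κ β g)) (croccoDomain X) := by
  have hgc : ContinuousOn (fun p : ℝ × ℝ × ℝ => g p.2.2) (croccoDomain X) :=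
    ContinuousOn.comp (t := Ico 0 1)
      (fun s hs => (hg.hasDerivAt s hs).continuousAt.continuousWithinAt)
      continuous_snd.snd.continuousOn fun p hp => hp.2.2
  exact ContinuousOn.mul (by fun_prop) hgc

lemma hasEdgeLimit (hg : ConcaveProfile g g₁ g₂) (A κ β : ℝ) :
    HasEdgeLimit X (dampedProfile A κ β g) fun τ ξ => dampedProfile A κ β g τ ξ 1 := by
  intro τ _ ξ _
  have hthd : Tendsto (fun p : ℝ × ℝ × ℝ => p.2.2) (𝓝[croccoDomain X] (τ, ξ, 1)) (𝓝[Ico 0 1] 1) :=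
    (continuous_snd.snd.continuousWithinAt (x := (τ, ξ, 1))).tendsto_nhdsWithin fun p hp => hp.2.2
  have hexp : Continuous fun p : ℝ × ℝ × ℝ => A * Real.exp (-(κ * p.1 + β * p.2.1)) := by fun_prop
  exact (tendsto_nhdsWithin_of_tendsto_nhds (hexp.tendsto (τ, ξ, 1))).mul
    (hg.edge.tendsto.comp hthd)

lemma dampedProfile_nonneg (hg : ConcaveProfile g g₁ g₂) (hA : 0 ≤ A) {τ ξ η : ℝ}
    (hη : η ∈ Icc (0 : ℝ) 1) : 0 ≤ dampedProfile A κ β g τ ξ η :=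
  mul_nonneg (mul_nonneg hA (Real.exp_pos _).le) (hg.nonneg η hη)

variable {D Dt Dx Dy Dyy a c : ℝ → ℝ → ℝ → ℝ}

theorem le_dampedProfile (hg : ConcaveProfile g g₁ g₂)
    (hd : HasParabolicDerivs X D Dt Dx Dy Dyy) (hD : ContinuousOn (unc D) (croccoDomain X))
    (hedge : HasEdgeLimit X D fun _ _ => 0) (hwall : ∀ τ ≥ 0, ∀ ξ ∈ Icc 0 X, Dy τ ξ 0 = 0)
    (ha : ∀ p ∈ croccoDomain X, 0 ≤ unc a p) (hc : ∀ p ∈ croccoDomain X, unc c p ≤ 0)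
    (hpde : ∀ τ ξ η, (τ, ξ, η) ∈ croccoDomain X →
      Dt τ ξ η + η * Dx τ ξ η = a τ ξ η * Dyy τ ξ η + c τ ξ η * D τ ξ η)
    (hsuper : ∀ τ ξ η, (τ, ξ, η) ∈ croccoDomain X → (κ + η * β) * g η + a τ ξ η * g₂ η ≤ 0)
    (hA : 0 ≤ A) (hdata : ∀ p ∈ parabolicBoundary X, unc D p ≤ unc (dampedProfile A κ β g) p) :
    ∀ p ∈ croccoDomain X, unc D p ≤ unc (dampedProfile A κ β g) p := by
  refine fun p hp => sub_nonpos.1 (max_principle (hd.sub (hg.hasParabolicDerivs A κ β))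
    (hD.sub (hg.continuousOn_dampedProfile A κ β)) (hedge.sub (hg.hasEdgeLimit A κ β)) ?_
    (fun q hq => sub_nonpos.2 (hdata q hq)) ?_ ?_ p hp)
  · exact fun τ _ ξ _ => sub_nonpos.2 (hg.dampedProfile_nonneg hA (right_mem_Icc.2 zero_le_one))
  · intro τ hτ ξ hξ
    rw [Pi.sub_apply, Pi.sub_apply, Pi.sub_apply, hwall τ hτ ξ hξ, zero_sub, neg_nonneg]
    exact mul_nonpos_of_nonneg_of_nonpos (mul_nonneg hA (Real.exp_pos _).le) hg.wall
  · intro τ ξ η hp hpos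
    refine ⟨a τ ξ η, ha _ hp, ?_⟩
    have hDpos : 0 ≤ D τ ξ η :=
      (hg.dampedProfile_nonneg hA (Ico_subset_Icc_self hp.2.2)).trans (sub_pos.1 hpos).le
    have hcD : c τ ξ η * D τ ξ η ≤ 0 := mul_nonpos_of_nonpos_of_nonneg (hc _ hp) hDpos
    have hbarrier := mul_nonpos_of_nonneg_of_nonpos
      (mul_nonneg hA (Real.exp_pos (-(κ * τ + β * ξ))).le) (hsuper τ ξ η hp)
    simp only [Pi.sub_apply, dampedProfile]
    linear_combination hpde τ ξ η hp + hcD + hbarrier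

theorem abs_le_dampedProfile (hg : ConcaveProfile g g₁ g₂)
    (hd : HasParabolicDerivs X D Dt Dx Dy Dyy) (hD : ContinuousOn (unc D) (croccoDomain X))
    (hedge : HasEdgeLimit X D fun _ _ => 0) (hwall : ∀ τ ≥ 0, ∀ ξ ∈ Icc 0 X, Dy τ ξ 0 = 0)
    (ha : ∀ p ∈ croccoDomain X, 0 ≤ unc a p) (hc : ∀ p ∈ croccoDomain X, unc c p ≤ 0)
    (hpde : ∀ τ ξ η, (τ, ξ, η) ∈ croccoDomain X →
      Dt τ ξ η + η * Dx τ ξ η = a τ ξ η * Dyy τ ξ η + c τ ξ η * D τ ξ η)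
    (hsuper : ∀ τ ξ η, (τ, ξ, η) ∈ croccoDomain X → (κ + η * β) * g η + a τ ξ η * g₂ η ≤ 0)
    (hA : 0 ≤ A) (hdata : ∀ p ∈ parabolicBoundary X, |unc D p| ≤ unc (dampedProfile A κ β g) p) :
    ∀ p ∈ croccoDomain X, |unc D p| ≤ unc (dampedProfile A κ β g) p := by
  refine fun p hp => abs_le'.2 ⟨?_, ?_⟩
  · exact hg.le_dampedProfile hd hD hedge hwall ha hc hpde hsuper hA
      (fun q hq => (le_abs_self _).trans (hdata q hq)) p hp
  · have hneg : HasParabolicDerivs X (-D) (-Dt) (-Dx) (-Dy) (-Dyy) :=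
      ⟨fun _ _ _ hp => (hd.time hp).neg, fun _ _ _ hp => (hd.tangential hp).neg,
        fun _ _ _ hp => (hd.normal hp).neg, fun _ _ _ hp => (hd.normal_normal hp).neg⟩
    refine hg.le_dampedProfile (D := -D) hneg hD.neg
      (fun τ hτ ξ hξ => neg_zero (G := ℝ) ▸ (hedge τ hτ ξ hξ).neg)
      (fun τ hτ ξ hξ => neg_eq_zero.2 (hwall τ hτ ξ hξ)) ha hc (fun τ ξ η hp => ?_) hsuper hA
      (fun q hq => (neg_le_abs _).trans (hdata q hq)) p hp
    simp only [Pi.neg_apply]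
    linear_combination -hpde τ ξ η hp

end ConcaveProfile

lemma concaveProfile_one : ConcaveProfile (fun _ => 1) (fun _ => 0) fun _ => 0 where
  nonneg _ _ := zero_le_one
  edge := continuousWithinAt_const
  hasDerivAt η _ := hasDerivAt_const η 1
  hasDerivAt_deriv η _ := hasDerivAt_const η 0
  wall := le_rfl
  concave _ _ := le_rfl

lemma concaveProfile_one_sub_cube :
    ConcaveProfile (fun η => 1 - η ^ 3) (fun η => -(3 * η ^ 2)) fun η => -(6 * η) where
  nonneg η hη := sub_nonneg.2 (pow_le_one₀ hη.1 hη.2)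
  edge := by fun_prop
  hasDerivAt η _ := by simpa using (hasDerivAt_pow 3 η).const_sub 1
  hasDerivAt_deriv η _ := (((hasDerivAt_pow 2 η).const_mul 3).neg).congr_deriv (by norm_num; ring)
  wall := by norm_num
  concave η hη := neg_nonpos.2 (mul_nonneg (by norm_num) hη.1)

lemma hasDerivAt_one_sub_rpow (p : ℝ) {η : ℝ} (hη : η < 1) :
    HasDerivAt (fun s : ℝ => (1 - s) ^ p) (-(p * (1 - η) ^ (p - 1))) η :=
  (((hasDerivAt_id η).const_sub 1).rpow_const (Or.inl (sub_pos.2 hη).ne')).congr_deriv (by simp)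

lemma concaveProfile_one_sub_rpow {α : ℝ} (hα : α ∈ Icc (0 : ℝ) 1) :
    ConcaveProfile (fun η => (1 - η) ^ α) (fun η => -(α * (1 - η) ^ (α - 1)))
      fun η => -(α * (1 - α) * (1 - η) ^ (α - 2)) where
  nonneg η hη := Real.rpow_nonneg (sub_nonneg.2 hη.2) α
  edge := ((continuous_const.sub continuous_id).rpow_const
    fun _ => Or.inr hα.1).continuousWithinAt
  hasDerivAt η hη := hasDerivAt_one_sub_rpow α hη.2
  hasDerivAt_deriv η hη := ((hasDerivAt_one_sub_rpow (α - 1) hη.2).const_mul α).neg.congr_deriv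
    (by ring_nf)
  wall := by simpa using hα.1
  concave η hη := neg_nonpos.2 (mul_nonneg (mul_nonneg hα.1 (sub_nonneg.2 hα.2))
    (Real.rpow_nonneg (sub_nonneg.2 hη.2.le) _))

end Comparison

section Barrier

/-- `√(-ln (μ (1 - η)))`, the logarithmic factor of the upper bound for `w`. -/
def sqrtNegLog (μ η : ℝ) : ℝ := Real.sqrt (-Real.log (μ * (1 - η)))

/-- The profile `(1 - η) √(-ln (μ (1 - η)))` of the upper bound for `w`. -/
def barrier (μ η : ℝ) : ℝ := (1 - η) * sqrtNegLog μ η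

variable {μ η : ℝ}

lemma barrier_nonneg (hη : η ≤ 1) : 0 ≤ barrier μ η :=
  mul_nonneg (sub_nonneg.2 hη) (Real.sqrt_nonneg _)

lemma neg_log_le_neg_log_mul (hμ : 0 < μ) (hη : η ∈ Ico (0 : ℝ) 1) :
    -Real.log μ ≤ -Real.log (μ * (1 - η)) :=
  neg_le_neg (Real.log_le_log (mul_pos hμ (sub_pos.2 hη.2))
    (mul_le_of_le_one_right hμ.le (sub_le_self 1 hη.1)))

lemma half_le_neg_log (hμ : μ ∈ Ioc 0 (Real.exp (-(1 / 2)))) : 1 / 2 ≤ -Real.log μ :=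
  le_neg_of_le_neg ((Real.log_le_iff_le_exp hμ.1).2 hμ.2)

lemma half_le_sqrtNegLog_sq (hμ : μ ∈ Ioc 0 (Real.exp (-(1 / 2)))) (hη : η ∈ Ico (0 : ℝ) 1) :
    1 / 2 ≤ sqrtNegLog μ η ^ 2 := by
  have h := (half_le_neg_log hμ).trans (neg_log_le_neg_log_mul hμ.1 hη)
  rwa [sqrtNegLog, Real.sq_sqrt (one_half_pos.le.trans h)]

lemma sqrtNegLog_pos (hμ : μ ∈ Ioc 0 (Real.exp (-(1 / 2)))) (hη : η ∈ Ico (0 : ℝ) 1) :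
    0 < sqrtNegLog μ η :=
  Real.sqrt_pos.2
    (one_half_pos.trans_le ((half_le_neg_log hμ).trans (neg_log_le_neg_log_mul hμ.1 hη)))

lemma hasDerivAt_sqrtNegLog (hμ : μ ∈ Ioc 0 (Real.exp (-(1 / 2)))) (hη : η ∈ Ico (0 : ℝ) 1) :
    HasDerivAt (sqrtNegLog μ) ((1 - η)⁻¹ / (2 * sqrtNegLog μ η)) η := by
  have hη₁ : 0 < 1 - η := sub_pos.2 hη.2
  have hμ₀ := hμ.1.ne'
  have hlog : HasDerivAt (fun s => -Real.log (μ * (1 - s))) (1 - η)⁻¹ η := by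
    refine ((((hasDerivAt_id η).const_sub 1).const_mul μ).log
      (mul_pos hμ.1 hη₁).ne').neg.congr_deriv ?_
    simp only [id_eq]
    field_simp
  exact hlog.sqrt (Real.sqrt_pos.1 (sqrtNegLog_pos hμ hη)).ne'

lemma hasDerivAt_barrier (hμ : μ ∈ Ioc 0 (Real.exp (-(1 / 2)))) (hη : η ∈ Ico (0 : ℝ) 1) :
    HasDerivAt (barrier μ) (-sqrtNegLog μ η + (2 * sqrtNegLog μ η)⁻¹) η := by
  have hη₁ : 1 - η ≠ 0 := (sub_pos.2 hη.2).ne'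
  have hs := (sqrtNegLog_pos hμ hη).ne'
  refine (((hasDerivAt_id η).const_sub 1).mul (hasDerivAt_sqrtNegLog hμ hη)).congr_deriv ?_
  simp only [id_eq]
  field_simp

lemma barrier_le_rpow {α : ℝ} (hμ : 0 < μ) (hα : α < 1) (hη : η < 1) :
    barrier μ η ≤ μ ^ (-(1 - α)) / Real.sqrt (2 * (1 - α)) * (1 - η) ^ α := by
  have hη₁ : 0 < 1 - η := sub_pos.2 hη
  have hα₂ : 0 < 2 * (1 - α) := mul_pos two_pos (sub_pos.2 hα)
  have hp : 0 < μ * (1 - η) := mul_pos hμ hη₁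
  have hlog : -Real.log (μ * (1 - η)) ≤ (μ * (1 - η))⁻¹ ^ (2 * (1 - α)) / (2 * (1 - α)) := by
    rw [← Real.log_inv]
    exact Real.log_le_rpow_div (inv_nonneg.2 hp.le) hα₂
  have hsqrt : Real.sqrt ((μ * (1 - η))⁻¹ ^ (2 * (1 - α))) = (μ * (1 - η)) ^ (-(1 - α)) := by
    rw [Real.sqrt_eq_iff_mul_self_eq (by positivity) (by positivity), ← Real.rpow_add hp,
      Real.inv_rpow hp.le, ← Real.rpow_neg hp.le]
    ring_nf
  calc barrier μ η
      ≤ (1 - η) * Real.sqrt ((μ * (1 - η))⁻¹ ^ (2 * (1 - α)) / (2 * (1 - α))) :=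
        mul_le_mul_of_nonneg_left (Real.sqrt_le_sqrt hlog) hη₁.le
    _ = μ ^ (-(1 - α)) / Real.sqrt (2 * (1 - α)) * ((1 - η) ^ (1 : ℝ) * (1 - η) ^ (-(1 - α))) := by
        rw [Real.sqrt_div (by positivity), hsqrt, Real.mul_rpow hμ.le hη₁.le, Real.rpow_one]
        ring
    _ = _ := by
        rw [← Real.rpow_add hη₁]
        ring_nf

lemma tendsto_barrier (hμ : 0 < μ) : Tendsto (barrier μ) (𝓝[Ico 0 1] 1) (𝓝 0) := by
  have hpow : Tendsto (fun s : ℝ => μ ^ (-(1 - 1 / 2 : ℝ)) / Real.sqrt (2 * (1 - 1 / 2))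
      * (1 - s) ^ (1 / 2 : ℝ)) (𝓝[Ico 0 1] 1) (𝓝 0) := by
    have hcont : Continuous fun s : ℝ => (1 - s) ^ (1 / 2 : ℝ) :=
      (continuous_const.sub continuous_id).rpow_const fun _ => Or.inr (by norm_num)
    simpa using ((hcont.tendsto 1).const_mul _).mono_left nhdsWithin_le_nhds
  refine tendsto_of_tendsto_of_tendsto_of_le_of_le' tendsto_const_nhds hpow ?_ ?_
  · filter_upwards [self_mem_nhdsWithin] with s hs using barrier_nonneg hs.2.le
  · filter_upwards [self_mem_nhdsWithin] with s hs using barrier_le_rpow hμ one_half_lt_one hs.2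

lemma concaveProfile_barrier (hμ : μ ∈ Ioc 0 (Real.exp (-(1 / 2)))) :
    ConcaveProfile (barrier μ) (fun η => -sqrtNegLog μ η + (2 * sqrtNegLog μ η)⁻¹) fun η =>
      -((1 - η)⁻¹ / (2 * sqrtNegLog μ η) * (1 + 2 / (2 * sqrtNegLog μ η) ^ 2)) where
  nonneg η hη := barrier_nonneg hη.2
  edge := by simpa [ContinuousWithinAt, barrier] using tendsto_barrier hμ.1
  hasDerivAt η hη := hasDerivAt_barrier hμ hη
  hasDerivAt_deriv η hη := by
    have hs := sqrtNegLog_pos hμ hη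
    have hds := hasDerivAt_sqrtNegLog hμ hη
    refine (hds.neg.add ((hds.const_mul 2).inv (by positivity))).congr_deriv ?_
    ring
  wall := by
    have h0 : (0 : ℝ) ∈ Ico (0 : ℝ) 1 := left_mem_Ico.2 one_pos
    have hs := sqrtNegLog_pos hμ h0
    rw [neg_add_nonpos_iff, inv_le_iff_one_le_mul₀ (by positivity)]
    linarith [half_le_sqrtNegLog_sq hμ h0]
  concave η hη := by
    have hs := sqrtNegLog_pos hμ hη
    have hη₁ : 0 < 1 - η := sub_pos.2 hη.2
    exact neg_nonpos.2 (by positivity)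

lemma barrier_sq_le (hμ : μ ∈ Ioc 0 (Real.exp (-(1 / 2)))) (hη : η ∈ Ico (0 : ℝ) 1) :
    barrier μ η ^ 2 ≤ (1 - Real.log μ) * (1 - η) := by
  have hη₁ : 0 < 1 - η := sub_pos.2 hη.2
  have hlogμ := one_half_pos.le.trans (half_le_neg_log hμ)
  have hentropy : -((1 - η) * Real.log (1 - η)) ≤ 1 := by
    have := mul_le_mul_of_nonneg_left (Real.one_sub_inv_le_log_of_pos hη₁) hη₁.le
    rw [mul_sub, mul_inv_cancel₀ hη₁.ne'] at this
    linarith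
  have hμη : (1 - η) * -Real.log μ ≤ -Real.log μ :=
    mul_le_of_le_one_left hlogμ (sub_le_self 1 hη.1)
  calc barrier μ η ^ 2
      = (1 - η) * ((1 - η) * -Real.log μ + -((1 - η) * Real.log (1 - η))) := by
        rw [barrier, sqrtNegLog, mul_pow,
          Real.sq_sqrt (hlogμ.trans (neg_log_le_neg_log_mul hμ.1 hη)),
          Real.log_mul hμ.1.ne' hη₁.ne']
        ring
    _ ≤ (1 - η) * (-Real.log μ + 1) := mul_le_mul_of_nonneg_left (add_le_add hμη hentropy) hη₁.le
    _ = _ := by ring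

end Barrier

section Enclosure

lemma dampedProfile_one_sub_cube_le {c₀ β τ ξ η : ℝ} (hc₀ : 0 ≤ c₀) (hβξ : 0 ≤ β * ξ)
    (hη : η ∈ Ico (0 : ℝ) 1) :
    dampedProfile (c₀ / 3) 0 β (fun η => 1 - η ^ 3) τ ξ η ≤ c₀ * (1 - η) := by
  have hexp : Real.exp (-(0 * τ + β * ξ)) ≤ 1 := Real.exp_le_one_iff.2 (by linarith)
  have hcube : 1 - η ^ 3 ≤ 3 * (1 - η) := by
    have := one_add_mul_le_pow (show -2 ≤ η - 1 by linarith [hη.1]) 3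
    rw [add_sub_cancel] at this
    push_cast at this
    linarith
  have hcube₀ : 0 ≤ 1 - η ^ 3 := sub_nonneg.2 (pow_le_one₀ hη.1 hη.2.le)
  calc c₀ / 3 * Real.exp (-(0 * τ + β * ξ)) * (1 - η ^ 3)
      ≤ c₀ / 3 * 1 * (3 * (1 - η)) := by gcongr
    _ = c₀ * (1 - η) := by ring

/-- The two-sided bound `b (1 - η) ≤ w ≤ Φ(η)` on a subset of the Crocco domain. -/
def EnclosedOn (S : Set (ℝ × ℝ × ℝ)) (b : ℝ) (Φ : ℝ → ℝ) (w : ℝ → ℝ → ℝ → ℝ) : Prop :=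
  ∀ p ∈ S, b * (1 - p.2.2) ≤ unc w p ∧ unc w p ≤ Φ p.2.2

variable {X μ c₀ A β : ℝ} {u w : ℝ → ℝ → ℝ → ℝ} {g g₁ g₂ : ℝ → ℝ}

namespace IsMonotoneSolution

theorem w_le_profile (hX : 0 < X) (h : IsMonotoneSolution X u w) (hg : ConcaveProfile g g₁ g₂)
    (hA : 0 ≤ A) (hdata : ∀ p ∈ parabolicBoundary X, unc w p ≤ A * g p.2.2) :
    ∀ p ∈ croccoDomain X, unc w p ≤ A * g p.2.2 := by
  have key := hg.le_dampedProfile (κ := 0) (β := 0) (a := fun τ ξ η => w τ ξ η ^ 2) (c := 0)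
    (h.hasParabolicDerivs hX) h.continuousOn_w h.edge_w (fun τ hτ ξ hξ => h.dY_w_wall hX hτ hξ)
    (fun p _ => sq_nonneg (w p.1 p.2.1 p.2.2)) (fun _ _ => le_rfl) (fun τ ξ η hp => ?_)
    (fun τ ξ η hp => ?_) hA (by simpa [unc, dampedProfile] using hdata)
  · simpa [unc, dampedProfile] using key
  · simpa using h.crocco_equation hX hp
  · simpa using mul_nonpos_of_nonneg_of_nonpos (sq_nonneg (w τ ξ η)) (hg.concave η hp.2.2)

theorem dampedProfile_le_w (hX : 0 < X) (h : IsMonotoneSolution X u w) (hc₀ : 0 ≤ c₀) (hβ : 0 ≤ β)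
    (hupper : ∀ p ∈ croccoDomain X, 6 * unc w p ^ 2 ≤ β * (1 - p.2.2))
    (hdata : ∀ p ∈ parabolicBoundary X, c₀ * (1 - p.2.2) ≤ unc w p) :
    ∀ p ∈ croccoDomain X, unc (dampedProfile (c₀ / 3) 0 β fun η => 1 - η ^ 3) p ≤ unc w p := by
  have hg := concaveProfile_one_sub_cube
  refine fun p hp => sub_nonpos.1 (max_principle
    ((hg.hasParabolicDerivs (c₀ / 3) 0 β).sub (h.hasParabolicDerivs hX))
    ((hg.continuousOn_dampedProfile _ _ _).sub h.continuousOn_w)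
    ((hg.hasEdgeLimit _ _ _).sub h.edge_w) ?_ ?_ ?_ ?_ p hp)
  · intro τ _ ξ _
    simp [dampedProfile]
  · rintro ⟨τ, ξ, η⟩ ⟨⟨hτ, hξ, hη : η ∈ Ico 0 1⟩, hbdry⟩
    exact sub_nonpos.2 ((dampedProfile_one_sub_cube_le hc₀ (mul_nonneg hβ hξ.1) hη).trans
      (hdata _ ⟨⟨hτ, hξ, hη⟩, hbdry⟩))
  · intro τ hτ ξ hξ
    simp [dampedProfile, h.dY_w_wall hX hτ hξ]
  · intro τ ξ η hp _
    have hη : η ∈ Ico 0 1 := hp.2.2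
    refine ⟨w τ ξ η ^ 2, sq_nonneg _, ?_⟩
    have hw2 : 6 * w τ ξ η ^ 2 ≤ β * (1 - η ^ 3) := (hupper _ hp).trans
      (mul_le_mul_of_nonneg_left (sub_le_sub_left (pow_le_of_le_one hη.1 hη.2.le three_ne_zero) 1)
        hβ)
    have hsub : 0 ≤ c₀ / 3 * Real.exp (-(0 * τ + β * ξ)) * η
        * (β * (1 - η ^ 3) - 6 * w τ ξ η ^ 2) :=
      mul_nonneg (mul_nonneg (by positivity) hη.1) (sub_nonneg.2 hw2)
    simp only [Pi.sub_apply, dampedProfile]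
    linear_combination hsub - h.crocco_equation hX hp

end IsMonotoneSolution

/-- The constant `β` of the stability theorem, chosen such that `6 w² ≤ β (1 - η)`. -/
def betaConst (μ c₀ : ℝ) : ℝ := 6 * c₀⁻¹ ^ 2 * (1 - Real.log μ)

lemma betaConst_pos (hμ : μ ∈ Ioc 0 (Real.exp (-(1 / 2)))) (hc₀ : 0 < c₀) :
    0 < betaConst μ c₀ := by
  have hlog : 0 < 1 - Real.log μ := by linarith [half_le_neg_log hμ]
  rw [betaConst]
  positivity

lemma bConst_pos (β X : ℝ) (hc₀ : 0 < c₀) : 0 < bConst c₀ β X := by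
  rw [bConst]
  positivity

lemma bConst_mul_le_dampedProfile (hc₀ : 0 ≤ c₀) (hβ : 0 ≤ β) {τ ξ η : ℝ} (hξ : ξ ≤ X)
    (hη : η ∈ Icc (0 : ℝ) 1) :
    bConst c₀ β X * (1 - η) ≤ dampedProfile (c₀ / 3) 0 β (fun η => 1 - η ^ 3) τ ξ η := by
  have hcube : 1 - η ≤ 1 - η ^ 3 :=
    sub_le_sub_left (pow_le_of_le_one hη.1 hη.2 three_ne_zero) 1
  have hη₁ : 0 ≤ 1 - η := sub_nonneg.2 hη.2
  have hexp : Real.exp (-(8 / 3)) ≤ 1 := Real.exp_le_one_iff.2 (by norm_num)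
  have hX : Real.exp (-(β * X)) ≤ Real.exp (-(0 * τ + β * ξ)) :=
    Real.exp_le_exp.2 (by linarith [mul_le_mul_of_nonneg_left hξ hβ])
  calc c₀ / 4 * Real.exp (-(β * X)) * Real.exp (-(8 / 3)) * (1 - η)
      ≤ c₀ / 3 * Real.exp (-(0 * τ + β * ξ)) * 1 * (1 - η ^ 3) := by gcongr; norm_num
    _ = dampedProfile (c₀ / 3) 0 β (fun η => 1 - η ^ 3) τ ξ η := by rw [dampedProfile, mul_one]

theorem IsMonotoneSolution.enclosedOn (hX : 0 < X) (hμ : μ ∈ Ioc 0 (Real.exp (-(1 / 2))))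
    (hc₀ : 0 < c₀) (h : IsMonotoneSolution X u w)
    (hdata : EnclosedOn (parabolicBoundary X) c₀ (fun η => c₀⁻¹ * barrier μ η) w) :
    EnclosedOn (croccoDomain X) (bConst c₀ (betaConst μ c₀) X) (fun η => c₀⁻¹ * barrier μ η) w := by
  have hβ := (betaConst_pos hμ hc₀).le
  have hupper := h.w_le_profile hX (concaveProfile_barrier hμ) (inv_pos.2 hc₀).le
    fun p hp => (hdata p hp).2
  have hsq : ∀ p ∈ croccoDomain X, 6 * unc w p ^ 2 ≤ betaConst μ c₀ * (1 - p.2.2) := by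
    intro p hp
    calc 6 * unc w p ^ 2 ≤ 6 * (c₀⁻¹ * barrier μ p.2.2) ^ 2 := by
          gcongr
          · exact (h.w_pos hp.1 hp.2.1 hp.2.2).le
          · exact hupper p hp
      _ = 6 * c₀⁻¹ ^ 2 * barrier μ p.2.2 ^ 2 := by ring
      _ ≤ 6 * c₀⁻¹ ^ 2 * ((1 - Real.log μ) * (1 - p.2.2)) := by
          gcongr
          exact barrier_sq_le hμ hp.2.2
      _ = _ := by rw [betaConst]; ring
  have hlower := h.dampedProfile_le_w hX hc₀.le hβ hsq fun p hp => (hdata p hp).1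
  exact fun p hp => ⟨(bConst_mul_le_dampedProfile hc₀.le hβ hp.2.1.2
    (Ico_subset_Icc_self hp.2.2)).trans (hlower p hp), hupper p hp⟩

end Enclosure

section Difference

/-- Two monotone solutions, the first with concave Crocco transform, both of whose Crocco transforms
are enclosed between `b (1 - η)` and `Φ(η)` on `S`. In the stability theorem `ū` is steady. -/
structure ComparisonPair (X : ℝ) (S : Set (ℝ × ℝ × ℝ)) (b : ℝ) (Φ : ℝ → ℝ)
    (ubar wbar u w : ℝ → ℝ → ℝ → ℝ) : Prop where
  reference : IsMonotoneSolution X ubar wbar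
  solution : IsMonotoneSolution X u w
  concave : ∀ p ∈ croccoInterior X, unc (dYY wbar) p ≤ 0
  bounds_reference : EnclosedOn S b Φ wbar
  bounds : EnclosedOn S b Φ w

namespace ComparisonPair

variable {X b A κ : ℝ} {S : Set (ℝ × ℝ × ℝ)} {Φ g g₁ g₂ : ℝ → ℝ} {ubar wbar u w : ℝ → ℝ → ℝ → ℝ}

lemma dYY_nonpos (hX : 0 < X) (h : ComparisonPair X S b Φ ubar wbar u w) :
    ∀ p ∈ croccoDomain X, unc (dYY wbar) p ≤ 0 := by
  have hclosure : croccoDomain X ⊆ closure (croccoInterior X) := by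
    rw [croccoInterior, closure_prod_eq, closure_prod_eq, closure_Ioi, closure_Ioc hX.ne,
      closure_Ioo zero_ne_one]
    exact prod_mono subset_rfl (prod_mono subset_rfl Ico_subset_Icc_self)
  have hmax : EqOn (fun p => max (unc (dYY wbar) p) 0) (fun _ => 0) (croccoDomain X) :=
    EqOn.of_subset_closure (fun p hp => max_eq_right (h.concave p hp))
      ((h.reference.continuousOn_dYY_w hX).sup continuousOn_const) continuousOn_const
      (prod_mono Ioi_subset_Ici_self (prod_mono Ioc_subset_Icc_self Ioo_subset_Ico_self)) hclosure
  exact fun p hp => max_eq_right_iff.1 (hmax hp)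

theorem abs_sub_le_profile (hX : 0 < X) (hb : 0 ≤ b)
    (h : ComparisonPair X (croccoDomain X) b Φ ubar wbar u w) (hg : ConcaveProfile g g₁ g₂)
    (hA : 0 ≤ A) (hsuper : ∀ η ∈ Ico (0 : ℝ) 1, κ * g η + (b * (1 - η)) ^ 2 * g₂ η ≤ 0)
    (hdata : ∀ p ∈ parabolicBoundary X,
      |unc w p - unc wbar p| ≤ A * Real.exp (-(κ * p.1)) * g p.2.2) :
    ∀ p ∈ croccoDomain X, |unc w p - unc wbar p| ≤ A * Real.exp (-(κ * p.1)) * g p.2.2 := by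
  -- Subtracting the Crocco equations gives `D_τ + η D_ξ = w² D_ηη + (w + w̄) w̄_ηη D` for
  -- `D = w - w̄`; concavity of `w̄` is what makes the zeroth-order coefficient nonpositive.
  have key := hg.abs_le_dampedProfile (κ := κ) (β := 0) (a := fun τ ξ η => w τ ξ η ^ 2)
    (c := fun τ ξ η => (w τ ξ η + wbar τ ξ η) * dYY wbar τ ξ η)
    ((h.solution.hasParabolicDerivs hX).sub (h.reference.hasParabolicDerivs hX))
    (h.solution.continuousOn_w.sub h.reference.continuousOn_w)
    (fun τ hτ ξ hξ => sub_zero (0 : ℝ) ▸ (h.solution.edge_w τ hτ ξ hξ).sub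
      (h.reference.edge_w τ hτ ξ hξ))
    (fun τ hτ ξ hξ => ?_) (fun p _ => sq_nonneg (w p.1 p.2.1 p.2.2)) (fun p hp => ?_)
    (fun τ ξ η hp => ?_) (fun τ ξ η hp => ?_) hA (by simpa [unc, dampedProfile] using hdata)
  · simpa [unc, dampedProfile] using key
  · rw [Pi.sub_apply, Pi.sub_apply, Pi.sub_apply, h.solution.dY_w_wall hX hτ hξ,
      h.reference.dY_w_wall hX hτ hξ, sub_zero]
  · exact mul_nonpos_of_nonneg_of_nonpos (add_nonneg (h.solution.w_pos hp.1 hp.2.1 hp.2.2).le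
      (h.reference.w_pos hp.1 hp.2.1 hp.2.2).le) (h.dYY_nonpos hX p hp)
  · simp only [Pi.sub_apply]
    linear_combination h.solution.crocco_equation hX hp - h.reference.crocco_equation hX hp
  · have hη : η ∈ Ico 0 1 := hp.2.2
    have hsq : (b * (1 - η)) ^ 2 ≤ w τ ξ η ^ 2 :=
      pow_le_pow_left₀ (mul_nonneg hb (sub_nonneg.2 hη.2.le)) (h.bounds _ hp).1 2
    rw [mul_zero, add_zero]
    linarith [hsuper η hη, mul_le_mul_of_nonpos_right hsq (hg.concave η hη)]

theorem abs_sub_le_const {M : ℝ} (hX : 0 < X) (hb : 0 ≤ b)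
    (h : ComparisonPair X (croccoDomain X) b Φ ubar wbar u w) (hM : 0 ≤ M)
    (hdata : ∀ p ∈ parabolicBoundary X, |unc w p - unc wbar p| ≤ M) :
    ∀ p ∈ croccoDomain X, |unc w p - unc wbar p| ≤ M := by
  simpa using h.abs_sub_le_profile (κ := 0) hX hb concaveProfile_one hM (by simp)
    (by simpa using hdata)

theorem abs_sub_le_exp_mul_rpow {α : ℝ} (hX : 0 < X) (hb : 0 ≤ b)
    (h : ComparisonPair X (croccoDomain X) b Φ ubar wbar u w) (hA : 0 ≤ A)
    (hα : α ∈ Icc (0 : ℝ) 1) (hκ : κ ≤ b ^ 2 * α * (1 - α))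
    (hdata : ∀ p ∈ parabolicBoundary X,
      |unc w p - unc wbar p| ≤ A * Real.exp (-(κ * p.1)) * (1 - p.2.2) ^ α) :
    ∀ p ∈ croccoDomain X,
      |unc w p - unc wbar p| ≤ A * Real.exp (-(κ * p.1)) * (1 - p.2.2) ^ α := by
  refine h.abs_sub_le_profile hX hb (concaveProfile_one_sub_rpow hα) hA (fun η hη => ?_) hdata
  have hη₁ : 0 < 1 - η := sub_pos.2 hη.2
  have hsplit : (1 - η) ^ α = (1 - η) ^ 2 * (1 - η) ^ (α - 2) := by
    rw [← Real.rpow_natCast (1 - η) 2, ← Real.rpow_add hη₁]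
    ring_nf
  have hrate := mul_le_mul_of_nonneg_right hκ (Real.rpow_nonneg hη₁.le α)
  rw [hsplit] at hrate ⊢
  linear_combination hrate

end ComparisonPair

end Difference

section Inversion

variable {f g : ℝ → ℝ} {a c m B M : ℝ}

lemma sub_div_le_integral_inv (hac : a ≤ c) (hg : ContinuousOn g (Icc a c))
    (hpos : ∀ s ∈ Icc a c, 0 < g s) (hB : ∀ s ∈ Icc a c, g s ≤ B) :
    (c - a) / B ≤ ∫ s in a..c, (g s)⁻¹ := by
  have h := intervalIntegral.integral_mono_on hac (μ := MeasureTheory.volume)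
    (f := fun _ => B⁻¹) (g := fun s => (g s)⁻¹) intervalIntegrable_const
    ((hg.inv₀ fun s hs => (hpos s hs).ne').intervalIntegrable_of_Icc hac)
    fun s hs => inv_anti₀ (hpos s hs) (hB s hs)
  rwa [intervalIntegral.integral_const, smul_eq_mul, ← div_eq_mul_inv] at h

lemma abs_integral_inv_sub_inv_le (hac : a ≤ c) (hm : 0 < m) (hmf : ∀ s ∈ Icc a c, m ≤ f s)
    (hmg : ∀ s ∈ Icc a c, m ≤ g s) (hd : ∀ s ∈ Icc a c, |f s - g s| ≤ M) :
    |∫ s in a..c, ((f s)⁻¹ - (g s)⁻¹)| ≤ M / m ^ 2 * (c - a) := by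
  rw [← abs_of_nonneg (sub_nonneg.2 hac), ← Real.norm_eq_abs (∫ _ in _.._, _)]
  refine intervalIntegral.norm_integral_le_of_norm_le_const fun s hs => ?_
  rw [uIoc_of_le hac] at hs
  have hs' := Ioc_subset_Icc_self hs
  have hf := hm.trans_le (hmf s hs')
  have hg := hm.trans_le (hmg s hs')
  rw [inv_sub_inv hf.ne' hg.ne', Real.norm_eq_abs, abs_div, abs_of_pos (mul_pos hf hg),
    abs_sub_comm, sq]
  exact div_le_div₀ ((abs_nonneg _).trans (hd s hs')) (hd s hs') (mul_pos hm hm)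
    (mul_le_mul (hmf s hs') (hmg s hs') hm.le hf.le)

lemma sub_le_of_integral_inv_eq (ha : a ∈ Icc (0 : ℝ) 1) (hac : a ≤ c)
    (hf : ContinuousOn f (Icc 0 a)) (hg : ContinuousOn g (Icc 0 c)) (hm : 0 < m)
    (hmf : ∀ s ∈ Icc 0 a, m ≤ f s) (hmg : ∀ s ∈ Icc 0 a, m ≤ g s)
    (hgpos : ∀ s ∈ Icc 0 c, 0 < g s) (hgB : ∀ s ∈ Icc 0 c, g s ≤ B)
    (hd : ∀ s ∈ Icc 0 a, |f s - g s| ≤ M)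
    (heq : ∫ s in (0 : ℝ)..a, (f s)⁻¹ = ∫ s in (0 : ℝ)..c, (g s)⁻¹) :
    c - a ≤ B * M / m ^ 2 := by
  have hsub : Icc a c ⊆ Icc 0 c := Icc_subset_Icc_left ha.1
  have hzero : (0 : ℝ) ∈ Icc 0 a := left_mem_Icc.2 ha.1
  have hM : 0 ≤ M := (abs_nonneg _).trans (hd 0 hzero)
  have hB : 0 < B := (hgpos c (right_mem_Icc.2 (ha.1.trans hac))).trans_le
    (hgB c (right_mem_Icc.2 (ha.1.trans hac)))
  have hfi : IntervalIntegrable (fun s => (f s)⁻¹) MeasureTheory.volume 0 a :=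
    (hf.inv₀ fun s hs => (hm.trans_le (hmf s hs)).ne').intervalIntegrable_of_Icc ha.1
  have hgi : ContinuousOn (fun s => (g s)⁻¹) (Icc 0 c) := hg.inv₀ fun s hs => (hgpos s hs).ne'
  have hgi₀ := (hgi.mono (Icc_subset_Icc_right hac)).intervalIntegrable_of_Icc
    (μ := MeasureTheory.volume) ha.1
  have hgi₁ := (hgi.mono hsub).intervalIntegrable_of_Icc (μ := MeasureTheory.volume) hac
  have hsplit : ∫ s in a..c, (g s)⁻¹ = ∫ s in (0 : ℝ)..a, ((f s)⁻¹ - (g s)⁻¹) := by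
    rw [intervalIntegral.integral_sub hfi hgi₀, heq, eq_sub_iff_add_eq',
      intervalIntegral.integral_add_adjacent_intervals hgi₀ hgi₁]
  have hle : (c - a) / B ≤ M / m ^ 2 :=
    calc (c - a) / B ≤ ∫ s in a..c, (g s)⁻¹ := sub_div_le_integral_inv hac (hg.mono hsub)
          (fun s hs => hgpos s (hsub hs)) fun s hs => hgB s (hsub hs)
      _ ≤ M / m ^ 2 * (a - 0) := hsplit.trans_le
          ((le_abs_self _).trans (abs_integral_inv_sub_inv_le ha.1 hm hmf hmg hd))
      _ ≤ M / m ^ 2 := mul_le_of_le_one_right (by positivity) (by linarith [ha.2])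
  rw [div_le_iff₀ hB] at hle
  exact hle.trans_eq (by ring)

end Inversion

namespace IsMonotoneSolution

variable {X b B M ε κ t x y : ℝ} {u w u₁ w₁ u₂ w₂ : ℝ → ℝ → ℝ → ℝ}

theorem integral_inv_w (h : IsMonotoneSolution X u w) (ht : 0 ≤ t) (hx : x ∈ Icc 0 X)
    (hy : 0 ≤ y) : ∫ s in (0 : ℝ)..u t x y, (w t x s)⁻¹ = y := by
  have hsub : uIcc 0 y ⊆ Ici 0 := uIcc_of_le hy ▸ Icc_subset_Ici_self
  have hcomp := intervalIntegral.integral_comp_mul_deriv'' (a := 0) (b := y) (f := u t x)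
    (f' := dY u t x) (g := fun s => (w t x s)⁻¹) ((h.continuousOn_u_slice ht hx).mono hsub)
    (fun z hz => by
      rw [min_eq_left hy] at hz
      exact (h.hasDerivWithinAt_u ht hx hz.1.le).mono (Ioi_subset_Ici hz.1.le))
    (fun z hz => (h.hasDerivWithinAt_dY_u ht hx (hsub hz)).continuousWithinAt.mono hsub)
    (((h.continuousOn_w_slice ht hx).inv₀ fun s hs => (h.w_pos ht hx hs).ne').mono
      (image_subset_iff.2 fun z hz => h.u_mem ht hx (hsub hz)))
  rw [h.u_wall ht hx] at hcomp
  have hone : EqOn (fun z => ((fun s => (w t x s)⁻¹) ∘ u t x) z * dY u t x z) (fun _ => 1)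
      (uIcc 0 y) := fun z hz => by
    simp only [Function.comp_apply]
    rw [h.crocco t ht x hx z (hsub hz),
      inv_mul_cancel₀ (h.monotone t ht x hx z (hsub hz)).ne']
  rw [← hcomp, intervalIntegral.integral_congr hone]
  simp

lemma sub_le_of_u_le (h₁ : IsMonotoneSolution X u₁ w₁) (h₂ : IsMonotoneSolution X u₂ w₂)
    (hb : 0 < b) (he₁ : EnclosedOn (croccoDomain X) b (fun _ => B) w₁)
    (he₂ : EnclosedOn (croccoDomain X) b (fun _ => B) w₂) (ht : 0 ≤ t) (hx : x ∈ Icc 0 X)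
    (hy : 0 ≤ y) (hd : ∀ η ∈ Ico (0 : ℝ) 1, |w₁ t x η - w₂ t x η| ≤ M) (hκ : 0 < κ)
    (hu : u₁ t x y ≤ 1 - κ) (hle : u₁ t x y ≤ u₂ t x y) :
    u₂ t x y - u₁ t x y ≤ B * M / (b * κ) ^ 2 := by
  have hm₁ := h₁.u_mem ht hx hy
  have hm₂ := h₂.u_mem ht hx hy
  have hsub₁ : Icc 0 (u₁ t x y) ⊆ Ico 0 1 := Icc_subset_Ico_right hm₁.2
  have hsub₂ : Icc 0 (u₂ t x y) ⊆ Ico 0 1 := Icc_subset_Ico_right hm₂.2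
  have hlower {s : ℝ} (hs : s ∈ Icc 0 (u₁ t x y)) : b * κ ≤ b * (1 - s) :=
    mul_le_mul_of_nonneg_left (by linarith [hs.2]) hb.le
  exact sub_le_of_integral_inv_eq (Ico_subset_Icc_self hm₁) hle
    ((h₁.continuousOn_w_slice ht hx).mono hsub₁) ((h₂.continuousOn_w_slice ht hx).mono hsub₂)
    (mul_pos hb hκ) (fun s hs => (hlower hs).trans (he₁ (t, x, s) ⟨ht, hx, hsub₁ hs⟩).1)
    (fun s hs => (hlower hs).trans (he₂ (t, x, s) ⟨ht, hx, hsub₁ hs⟩).1)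
    (fun s hs => h₂.w_pos ht hx (hsub₂ hs)) (fun s hs => (he₂ (t, x, s) ⟨ht, hx, hsub₂ hs⟩).2)
    (fun s hs => hd s (hsub₁ hs))
    ((h₁.integral_inv_w ht hx hy).trans (h₂.integral_inv_w ht hx hy).symm)

theorem abs_sub_le_of_min_le (h₁ : IsMonotoneSolution X u₁ w₁) (h₂ : IsMonotoneSolution X u₂ w₂)
    (hb : 0 < b) (he₁ : EnclosedOn (croccoDomain X) b (fun _ => B) w₁)
    (he₂ : EnclosedOn (croccoDomain X) b (fun _ => B) w₂) (ht : 0 ≤ t) (hx : x ∈ Icc 0 X)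
    (hy : 0 ≤ y) (hd : ∀ η ∈ Ico (0 : ℝ) 1, |w₁ t x η - w₂ t x η| ≤ M) (hκ : 0 < κ)
    (hu : min (u₁ t x y) (u₂ t x y) ≤ 1 - κ) :
    |u₁ t x y - u₂ t x y| ≤ B * M / (b * κ) ^ 2 := by
  rcases le_total (u₁ t x y) (u₂ t x y) with hle | hle
  · rw [abs_sub_comm, abs_of_nonneg (sub_nonneg.2 hle)]
    exact h₁.sub_le_of_u_le h₂ hb he₁ he₂ ht hx hy hd hκ (min_eq_left hle ▸ hu) hle
  · rw [abs_of_nonneg (sub_nonneg.2 hle)]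
    exact h₂.sub_le_of_u_le h₁ hb he₂ he₁ ht hx hy
      (fun η hη => abs_sub_comm (w₂ t x η) _ ▸ hd η hη) hκ (min_eq_right hle ▸ hu) hle

theorem abs_sub_le_of_abs_w_sub_le (h₁ : IsMonotoneSolution X u₁ w₁)
    (h₂ : IsMonotoneSolution X u₂ w₂) (hb : 0 < b)
    (he₁ : EnclosedOn (croccoDomain X) b (fun _ => B) w₁)
    (he₂ : EnclosedOn (croccoDomain X) b (fun _ => B) w₂) (ht : 0 ≤ t) (hx : x ∈ Icc 0 X)
    (hy : 0 ≤ y) (hε : 0 < ε)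
    (hd : ∀ η ∈ Ico (0 : ℝ) 1, |w₁ t x η - w₂ t x η| ≤ ε ^ 3 * b ^ 2 / B) :
    |u₁ t x y - u₂ t x y| ≤ ε := by
  rcases le_or_gt (min (u₁ t x y) (u₂ t x y)) (1 - ε) with hu | hu
  · have hB : 0 < B := (h₁.w_pos ht hx ⟨le_rfl, one_pos⟩).trans_le
      (he₁ (t, x, 0) ⟨ht, hx, le_rfl, one_pos⟩).2
    refine (h₁.abs_sub_le_of_min_le h₂ hb he₁ he₂ ht hx hy hd hε hu).trans_eq ?_
    field_simp
  · obtain ⟨hu₁, hu₂⟩ := lt_min_iff.1 hu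
    rw [abs_le]
    constructor <;> linarith [(h₁.u_mem ht hx hy).2, (h₂.u_mem ht hx hy).2]

theorem sqrtNegLog_u_le {μ A : ℝ} (hμ : μ ∈ Ioc 0 (Real.exp (-(1 / 2))))
    (h : IsMonotoneSolution X u w) (ht : 0 ≤ t) (hx : x ∈ Icc 0 X)
    (hup : ∀ η ∈ Ico (0 : ℝ) 1, w t x η ≤ A * barrier μ η) (hy : 0 ≤ y) :
    sqrtNegLog μ (u t x y) ≤ sqrtNegLog μ 0 + A / 2 * y := by
  have hderiv : ∀ z ≥ 0, HasDerivWithinAt (fun z => sqrtNegLog μ (u t x z))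
      ((1 - u t x z)⁻¹ / (2 * sqrtNegLog μ (u t x z)) * dY u t x z) (Ici 0) z := fun z hz =>
    (hasDerivAt_sqrtNegLog hμ (h.u_mem ht hx hz)).comp_hasDerivWithinAt z
      (h.hasDerivWithinAt_u ht hx hz)
  refine image_le_of_deriv_right_le_deriv_boundary (a := 0) (b := y)
    (f := fun z => sqrtNegLog μ (u t x z)) (B := fun z => sqrtNegLog μ 0 + A / 2 * z)
    (B' := fun _ => A / 2)
    (fun z hz => ((hderiv z hz.1).continuousWithinAt).mono Icc_subset_Ici_self)
    (fun z hz => (hderiv z hz.1).mono (Ici_subset_Ici.2 hz.1))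
    (by simp [h.u_wall ht hx]) (by fun_prop)
    (fun z _ => by simpa using (((hasDerivAt_id z).const_mul (A / 2)).const_add
      (sqrtNegLog μ 0)).hasDerivWithinAt) (fun z hz => ?_) (right_mem_Icc.2 hy)
  have hm := h.u_mem ht hx hz.1
  have hs := sqrtNegLog_pos hμ hm
  have hu : 0 < 1 - u t x z := sub_pos.2 hm.2
  rw [← h.crocco t ht x hx z hz.1]
  calc (1 - u t x z)⁻¹ / (2 * sqrtNegLog μ (u t x z)) * w t x (u t x z)
      ≤ (1 - u t x z)⁻¹ / (2 * sqrtNegLog μ (u t x z)) * (A * barrier μ (u t x z)) :=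
        mul_le_mul_of_nonneg_left (hup _ hm) (by positivity)
    _ = A / 2 := by
        rw [barrier]
        field_simp

lemma exp_neg_sq_le_one_sub_u {μ A y₀ : ℝ} (hμ : μ ∈ Ioc 0 (Real.exp (-(1 / 2)))) (hA : 0 ≤ A)
    (h : IsMonotoneSolution X u w) (ht : 0 ≤ t) (hx : x ∈ Icc 0 X)
    (hup : ∀ η ∈ Ico (0 : ℝ) 1, w t x η ≤ A * barrier μ η) (hy : y ∈ Icc 0 y₀) :
    Real.exp (-(sqrtNegLog μ 0 + A / 2 * y₀) ^ 2) ≤ 1 - u t x y := by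
  have hu : 0 < 1 - u t x y := sub_pos.2 (h.u_mem ht hx hy.1).2
  have hs : sqrtNegLog μ (u t x y) ≤ sqrtNegLog μ 0 + A / 2 * y₀ :=
    (h.sqrtNegLog_u_le hμ ht hx hup hy.1).trans (by gcongr; exact hy.2)
  have hμ₁ : μ ≤ 1 := hμ.2.trans (Real.exp_le_one_iff.2 (by norm_num))
  calc Real.exp (-(sqrtNegLog μ 0 + A / 2 * y₀) ^ 2)
      ≤ Real.exp (Real.log (μ * (1 - u t x y))) :=
        Real.exp_le_exp.2 (neg_le.1 (Real.sqrt_le_iff.1 hs).2)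
    _ = μ * (1 - u t x y) := Real.exp_log (mul_pos hμ.1 hu)
    _ ≤ 1 - u t x y := mul_le_of_le_one_left hu.le hμ₁

end IsMonotoneSolution

section Shear

lemma abs_deriv_le_of_antitoneOn {φ φ' : ℝ → ℝ} {B η : ℝ}
    (hφ : ∀ s ∈ Ico (0 : ℝ) 1, HasDerivWithinAt φ (φ' s) (Ici 0) s)
    (hanti : AntitoneOn φ' (Ico 0 1)) (hzero : φ' 0 ≤ 0) (hB : ∀ s ∈ Ico 0 1, φ s ∈ Icc 0 B)
    (hη : η ∈ Ico (0 : ℝ) 1) : |φ' η| ≤ 2 * B / (1 - η) := by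
  have hη₁ : 0 < 1 - η := sub_pos.2 hη.2
  have hlt : η < (η + 1) / 2 := by linarith
  have hsub : Icc η ((η + 1) / 2) ⊆ Ico 0 1 := fun s hs => ⟨hη.1.trans hs.1, by linarith [hs.2]⟩
  obtain ⟨ξ, hξ, hslope⟩ := exists_hasDerivAt_eq_slope φ φ' hlt
    (fun s hs => (hφ s (hsub hs)).continuousWithinAt.mono fun r hr => (hsub hr).1)
    (fun s hs => (hφ s (hsub (Ioo_subset_Icc_self hs))).hasDerivAt
      (Ici_mem_nhds (hη.1.trans_lt hs.1)))
  have hle : φ' ξ ≤ φ' η := hanti hη (hsub (Ioo_subset_Icc_self hξ)) hξ.1.le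
  have hnonpos : φ' η ≤ 0 := (hanti ⟨le_rfl, one_pos⟩ hη hη.1).trans hzero
  rw [abs_of_nonpos hnonpos, le_div_iff₀ hη₁]
  rw [eq_div_iff (sub_pos.2 hlt).ne'] at hslope
  have := mul_le_mul_of_nonneg_right hle hη₁.le
  linarith [(hB η hη).2, (hB _ (hsub (right_mem_Icc.2 hlt.le))).1]

end Shear

namespace IsMonotoneSolution

variable {X b B κ δ t x y η η' : ℝ} {u w u₁ w₁ u₂ w₂ : ℝ → ℝ → ℝ → ℝ}

lemma antitoneOn_dY_w (hX : 0 < X) (h : IsMonotoneSolution X u w)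
    (hconc : ∀ p ∈ croccoDomain X, unc (dYY w) p ≤ 0) (ht : 0 ≤ t) (hx : x ∈ Icc 0 X) :
    AntitoneOn (dY w t x) (Ico 0 1) := by
  have hderiv {s : ℝ} (hs : s ∈ Ico (0 : ℝ) 1) :=
    (h.hasParabolicDerivs hX).normal_normal ⟨ht, hx, hs⟩
  refine antitoneOn_of_deriv_nonpos (convex_Ico 0 1)
    (fun s hs => (hderiv hs).continuousWithinAt.mono Ico_subset_Ici_self) ?_ ?_
  all_goals
    intro s hs
    rw [interior_Ico] at hs
    have hat := (hderiv (Ioo_subset_Ico_self hs)).hasDerivAt (Ici_mem_nhds hs.1)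
  · exact hat.differentiableAt.differentiableWithinAt
  · exact hat.deriv.trans_le (hconc (t, x, s) ⟨ht, hx, Ioo_subset_Ico_self hs⟩)

lemma abs_w_sub_le (hX : 0 < X) (h : IsMonotoneSolution X u w)
    (hconc : ∀ p ∈ croccoDomain X, unc (dYY w) p ≤ 0) (ht : 0 ≤ t) (hx : x ∈ Icc 0 X)
    (hB : ∀ s ∈ Ico (0 : ℝ) 1, w t x s ≤ B) (hκ : 0 < κ) (hη : η ∈ Icc 0 (1 - κ))
    (hη' : η' ∈ Icc 0 (1 - κ)) : |w t x η - w t x η'| ≤ 2 * B / κ * |η - η'| := by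
  have hsub : Icc 0 (1 - κ) ⊆ Ico 0 1 := Icc_subset_Ico_right (sub_lt_self 1 hκ)
  have hderiv {s : ℝ} (hs : s ∈ Ico (0 : ℝ) 1) :=
    (h.hasParabolicDerivs hX).normal ⟨ht, hx, hs⟩
  refine (convex_Icc 0 (1 - κ)).norm_image_sub_le_of_norm_hasDerivWithin_le (f' := dY w t x)
    (fun s hs => (hderiv (hsub hs)).mono Icc_subset_Ici_self) (fun s hs => ?_) hη' hη
  have hB₀ : 0 < B := (h.w_pos ht hx (hsub hs)).trans_le (hB s (hsub hs))
  calc |dY w t x s| ≤ 2 * B / (1 - s) :=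
        abs_deriv_le_of_antitoneOn (fun r hr => hderiv hr) (h.antitoneOn_dY_w hX hconc ht hx)
          (h.dY_w_wall hX ht hx).le (fun r hr => ⟨(h.w_pos ht hx hr).le, hB r hr⟩) (hsub hs)
    _ ≤ 2 * B / κ := by
        gcongr
        linarith [hs.2]

lemma le_inv_of_u_le (h : IsMonotoneSolution X u w) (hb : 0 < b) (ht : 0 ≤ t) (hx : x ∈ Icc 0 X)
    (hlower : ∀ s ∈ Ico (0 : ℝ) 1, b * (1 - s) ≤ w t x s) (hy : 0 ≤ y) (hκ : 0 < κ)
    (hu : u t x y ≤ 1 - κ) : y ≤ (b * κ)⁻¹ := by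
  have hm := h.u_mem ht hx hy
  have hbound : ∀ s ∈ uIoc 0 (u t x y), ‖(w t x s)⁻¹‖ ≤ (b * κ)⁻¹ := by
    intro s hs
    rw [uIoc_of_le hm.1] at hs
    have hs' : s ∈ Ico (0 : ℝ) 1 := ⟨hs.1.le, hs.2.trans_lt hm.2⟩
    rw [Real.norm_of_nonneg (inv_nonneg.2 (h.w_pos ht hx hs').le)]
    exact inv_anti₀ (mul_pos hb hκ) ((mul_le_mul_of_nonneg_left (by linarith [hs.2])
      hb.le).trans (hlower s hs'))
  have hint := intervalIntegral.norm_integral_le_of_norm_le_const hbound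
  rw [h.integral_inv_w ht hx hy, Real.norm_of_nonneg hy, sub_zero, abs_of_nonneg hm.1] at hint
  exact hint.trans (mul_le_of_le_one_right (by positivity) hm.2.le)

lemma abs_sub_le_of_abs_dY_sub_le (h₁ : IsMonotoneSolution X u₁ w₁)
    (h₂ : IsMonotoneSolution X u₂ w₂) (ht : 0 ≤ t) (hx : x ∈ Icc 0 X)
    (hd : ∀ z ≥ 0, |dY u₁ t x z - dY u₂ t x z| ≤ δ) (hy : 0 ≤ y) :
    |u₁ t x y - u₂ t x y| ≤ δ * y := by
  have hmvt := (convex_Ici (0 : ℝ)).norm_image_sub_le_of_norm_hasDerivWithin_le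
    (f := fun z => u₁ t x z - u₂ t x z) (C := δ)
    (fun z hz => (h₁.hasDerivWithinAt_u ht hx hz).sub (h₂.hasDerivWithinAt_u ht hx hz))
    hd self_mem_Ici hy
  simpa [h₁.u_wall ht hx, h₂.u_wall ht hx, abs_of_nonneg hy] using hmvt

end IsMonotoneSolution

section Stability

variable {X μ b c B A M α κ δ ε t x y η : ℝ} {Φ Ψ : ℝ → ℝ} {ubar wbar u w : ℝ → ℝ → ℝ → ℝ}

lemma EnclosedOn.mono (h : EnclosedOn (croccoDomain X) b Φ w)
    (hΦ : ∀ η ∈ Ico (0 : ℝ) 1, Φ η ≤ Ψ η) : EnclosedOn (croccoDomain X) b Ψ w :=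
  fun p hp => ⟨(h p hp).1, (h p hp).2.trans (hΦ _ hp.2.2)⟩

lemma exists_mul_barrier_le_rpow (hμ : 0 < μ) (hc : 0 < c) (hα : α < 1) :
    ∃ A > 0, ∀ η < 1, c * barrier μ η ≤ A * (1 - η) ^ α := by
  have : 0 < 2 * (1 - α) := mul_pos two_pos (sub_pos.2 hα)
  refine ⟨c * (μ ^ (-(1 - α)) / Real.sqrt (2 * (1 - α))), by positivity, fun η hη => ?_⟩
  rw [mul_assoc]
  exact mul_le_mul_of_nonneg_left (barrier_le_rpow hμ hα hη) hc.le

lemma exists_mul_barrier_le (hμ : 0 < μ) (hc : 0 < c) :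
    ∃ B > 0, ∀ η ∈ Ico (0 : ℝ) 1, c * barrier μ η ≤ B := by
  obtain ⟨B, hB, hle⟩ := exists_mul_barrier_le_rpow hμ hc one_pos
  exact ⟨B, hB, fun η hη => by simpa using hle η hη.2⟩

namespace ComparisonPair

lemma abs_w_sub_le_of_shear (hX : 0 < X) (hb : 0 < b)
    (h : ComparisonPair X (croccoDomain X) b Φ ubar wbar u w) (hΦ : ∀ η ∈ Ico 0 1, Φ η ≤ B)
    (ht : 0 ≤ t) (hx : x ∈ Icc 0 X) (hd : ∀ y ≥ 0, |dY u t x y - dY ubar t x y| ≤ δ)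
    (hκ : 0 < κ) (hδ : δ ≤ b * κ ^ 2 / 2) (hη : η ∈ Icc 0 (1 - κ)) :
    |w t x η - wbar t x η| ≤ δ * (1 + 4 * B / κ / (b * κ)) := by
  have hδ₀ : 0 ≤ δ := (abs_nonneg _).trans (hd 0 le_rfl)
  have hη₁ : η ∈ Ico (0 : ℝ) 1 := Icc_subset_Ico_right (sub_lt_self 1 hκ) hη
  have hwB : ∀ s ∈ Ico (0 : ℝ) 1, wbar t x s ≤ B := fun s hs =>
    (h.bounds_reference (t, x, s) ⟨ht, hx, hs⟩).2.trans (hΦ s hs)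
  have hB : 0 < B := (h.reference.w_pos ht hx hη₁).trans_le (hwB η hη₁)
  obtain ⟨y, hy, rfl⟩ := h.solution.exists_u_eq ht hx hη₁
  have hheight : y ≤ (b * κ)⁻¹ := h.solution.le_inv_of_u_le hb ht hx
    (fun s hs => (h.bounds (t, x, s) ⟨ht, hx, hs⟩).1) hy hκ hη.2
  have hgap : |u t x y - ubar t x y| ≤ δ * (b * κ)⁻¹ :=
    (h.solution.abs_sub_le_of_abs_dY_sub_le h.reference ht hx hd hy).trans
      (mul_le_mul_of_nonneg_left hheight hδ₀)
  have hhalf : δ * (b * κ)⁻¹ ≤ κ / 2 := by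
    rw [← div_eq_mul_inv, div_le_iff₀ (by positivity)]
    exact hδ.trans_eq (by ring)
  have hubar : ubar t x y ∈ Icc 0 (1 - κ / 2) :=
    ⟨(h.reference.u_mem ht hx hy).1, by linarith [hη.2, (abs_le.1 hgap).1]⟩
  have hshear := hd y hy
  rw [← h.solution.crocco t ht x hx y hy, ← h.reference.crocco t ht x hx y hy] at hshear
  calc |w t x (u t x y) - wbar t x (u t x y)|
      ≤ |w t x (u t x y) - wbar t x (ubar t x y)|
        + |wbar t x (u t x y) - wbar t x (ubar t x y)| := by
        rw [abs_sub_comm (wbar t x (u t x y))]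
        exact abs_sub_le _ _ _
    _ ≤ δ + 2 * B / (κ / 2) * (δ * (b * κ)⁻¹) := add_le_add hshear
        ((h.reference.abs_w_sub_le hX (h.dYY_nonpos hX) ht hx hwB (half_pos hκ)
          ⟨hη.1, by linarith [hη.2]⟩ hubar).trans (by gcongr))
    _ = δ * (1 + 4 * B / κ / (b * κ)) := by
        field_simp
        ring

lemma abs_w_sub_le (h : ComparisonPair X (croccoDomain X) b Φ ubar wbar u w)
    {p : ℝ × ℝ × ℝ} (hp : p ∈ croccoDomain X) : |unc w p - unc wbar p| ≤ Φ p.2.2 := by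
  have hw := h.solution.w_pos hp.1 hp.2.1 hp.2.2
  have hwbar := h.reference.w_pos hp.1 hp.2.1 hp.2.2
  exact abs_sub_le_of_nonneg_of_le hw.le (h.bounds p hp).2 hwbar.le (h.bounds_reference p hp).2

theorem exists_abs_w_sub_le_of_shear (hX : 0 < X) (hb : 0 < b) (hB : 0 < B)
    (hΦB : ∀ η ∈ Ico 0 1, Φ η ≤ B) (hΦ : Tendsto Φ (𝓝[Ico 0 1] 1) (𝓝 0)) (hM : 0 < M) :
    ∃ δ > 0, ∀ ubar wbar u w, ComparisonPair X (croccoDomain X) b Φ ubar wbar u w →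
      ∀ t ≥ 0, ∀ x ∈ Icc 0 X, (∀ y ≥ 0, |dY u t x y - dY ubar t x y| ≤ δ) →
        ∀ η ∈ Ico (0 : ℝ) 1, |w t x η - wbar t x η| ≤ M := by
  obtain ⟨κ, hκ, hedge⟩ := Metric.mem_nhdsWithin_iff.1 (hΦ.eventually (gt_mem_nhds hM))
  have hL : 0 < 1 + 4 * B / κ / (b * κ) := by positivity
  refine ⟨min (b * κ ^ 2 / 2) (M / (1 + 4 * B / κ / (b * κ))), by positivity,
    fun ubar wbar u w h t ht x hx hd η hη => ?_⟩
  rcases le_or_gt η (1 - κ) with hηκ | hηκ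
  · exact (h.abs_w_sub_le_of_shear hX hb hΦB ht hx hd hκ (min_le_left _ _) ⟨hη.1, hηκ⟩).trans
      ((le_div_iff₀ hL).1 (min_le_right _ _))
  · have hball : η ∈ Metric.ball 1 κ := by
      rw [Metric.mem_ball, dist_comm, Real.dist_eq, abs_of_pos (sub_pos.2 hη.2)]
      exact sub_lt_comm.1 hηκ
    exact (h.abs_w_sub_le (p := (t, x, η)) ⟨ht, hx, hη⟩).trans (hedge ⟨hball, hη⟩).le

theorem exists_orbital_stability (hX : 0 < X) (hb : 0 < b) (hB : 0 < B)
    (hΦB : ∀ η ∈ Ico 0 1, Φ η ≤ B) (hΦ : Tendsto Φ (𝓝[Ico 0 1] 1) (𝓝 0)) (hε : 0 < ε) :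
    ∃ δ > 0, ∀ ubar wbar u w, ComparisonPair X (croccoDomain X) b Φ ubar wbar u w →
      (∀ t ≥ 0, ∀ y ≥ 0, |dY u t 0 y - dY ubar t 0 y| ≤ δ) →
      (∀ x ∈ Icc 0 X, ∀ y ≥ 0, |dY u 0 x y - dY ubar 0 x y| ≤ δ) →
      ∀ t ≥ 0, ∀ x ∈ Icc 0 X, ∀ y ≥ 0, |ubar t x y - u t x y| ≤ ε := by
  have hM : 0 < ε ^ 3 * b ^ 2 / B := by positivity
  obtain ⟨δ, hδ, hcrocco⟩ := exists_abs_w_sub_le_of_shear hX hb hB hΦB hΦ hM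
  refine ⟨δ, hδ, fun ubar wbar u w h hinflow hinit t ht x hx y hy => ?_⟩
  have hdata : ∀ p ∈ parabolicBoundary X, |unc w p - unc wbar p| ≤ ε ^ 3 * b ^ 2 / B := by
    rintro ⟨t, x, η⟩ ⟨⟨ht, hx, hη⟩, rfl | rfl⟩
    · exact hcrocco ubar wbar u w h 0 le_rfl x hx (hinit x hx) η hη
    · exact hcrocco ubar wbar u w h t ht 0 hx (hinflow t ht) η hη
  have hdiff := h.abs_sub_le_const hX hb.le hM.le hdata
  rw [abs_sub_comm]
  exact h.solution.abs_sub_le_of_abs_w_sub_le h.reference hb (h.bounds.mono hΦB)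
    (h.bounds_reference.mono hΦB) ht hx hy hε fun η hη => hdiff (t, x, η) ⟨ht, hx, hη⟩

theorem abs_w_sub_le_exp {C₂ : ℝ} (hX : 0 < X) (hb : 0 ≤ b)
    (h : ComparisonPair X (croccoDomain X) b Φ ubar wbar u w) (hA : 0 ≤ A)
    (hα : α ∈ Icc (0 : ℝ) 1) (hκ : κ ≤ b ^ 2 * α * (1 - α))
    (hΦ : ∀ η < 1, Φ η ≤ A * (1 - η) ^ α)
    (hinflow : ∀ τ ≥ 0, ∀ η ∈ Ico (0 : ℝ) 1,
      |w τ 0 η - wbar τ 0 η| ≤ Real.exp (-τ * κ) * C₂ * (1 - η) ^ α)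
    (ht : 0 ≤ t) (hx : x ∈ Icc 0 X) (hη : η ∈ Ico (0 : ℝ) 1) :
    |w t x η - wbar t x η| ≤ max A C₂ * Real.exp (-t * κ) := by
  have hexp (τ : ℝ) : -τ * κ = -(κ * τ) := by ring
  have hA' : 0 ≤ max A C₂ := hA.trans (le_max_left _ _)
  have hpow {η : ℝ} (hη : η ∈ Ico (0 : ℝ) 1) : 0 ≤ (1 - η) ^ α :=
    Real.rpow_nonneg (sub_nonneg.2 hη.2.le) α
  have hdata : ∀ p ∈ parabolicBoundary X,
      |unc w p - unc wbar p| ≤ max A C₂ * Real.exp (-(κ * p.1)) * (1 - p.2.2) ^ α := by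
    rintro ⟨t, x, η⟩ ⟨hp, rfl | rfl⟩
    · have hinit := (h.abs_w_sub_le hp).trans (hΦ η hp.2.2.2)
      simpa using hinit.trans (mul_le_mul_of_nonneg_right (le_max_left A C₂) (hpow hp.2.2))
    · rw [← hexp, mul_comm (max A C₂)]
      refine (hinflow t hp.1 η hp.2.2).trans (mul_le_mul_of_nonneg_right ?_ (hpow hp.2.2))
      exact mul_le_mul_of_nonneg_left (le_max_right _ _) (Real.exp_pos _).le
  rw [hexp]
  exact (h.abs_sub_le_exp_mul_rpow hX hb hA' hα hκ hdata (t, x, η) ⟨ht, hx, hη⟩).trans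
    (mul_le_of_le_one_right (by positivity) (Real.rpow_le_one (sub_nonneg.2 hη.2.le)
      (sub_le_self 1 hη.1) hα.1))

theorem exists_local_exponential_stability {C₂ : ℝ} (hX : 0 < X) (hb : 0 < b)
    (hμ : μ ∈ Ioc 0 (Real.exp (-(1 / 2)))) (hc : 0 < c) (hα : α ∈ Ioo (0 : ℝ) 1) (y₀ : ℝ) :
    ∃ C > 0, ∀ κ ≤ b ^ 2 * α * (1 - α), ∀ ubar wbar u w,
      ComparisonPair X (croccoDomain X) b (fun η => c * barrier μ η) ubar wbar u w →
      (∀ τ ≥ 0, ∀ η ∈ Ico (0 : ℝ) 1,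
        |w τ 0 η - wbar τ 0 η| ≤ Real.exp (-τ * κ) * C₂ * (1 - η) ^ α) →
      ∀ t ≥ 0, ∀ x ∈ Icc 0 X, ∀ y ∈ Icc 0 y₀,
        |u t x y - ubar t x y| ≤ C * Real.exp (-t * κ) := by
  obtain ⟨A, hA, hpow⟩ := exists_mul_barrier_le_rpow hμ.1 hc hα.2
  obtain ⟨B, hB, hbound⟩ := exists_mul_barrier_le hμ.1 hc
  set ρ := Real.exp (-(sqrtNegLog μ 0 + c / 2 * y₀) ^ 2)
  have hρ₀ : 0 < ρ := Real.exp_pos _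
  have : 0 < max A C₂ := hA.trans_le (le_max_left _ _)
  refine ⟨B * max A C₂ / (b * ρ) ^ 2, by positivity,
    fun κ hκ ubar wbar u w h hinflow t ht x hx y hy => ?_⟩
  have hu : ρ ≤ 1 - u t x y := h.solution.exp_neg_sq_le_one_sub_u hμ hc.le ht hx
    (fun η hη => (h.bounds (t, x, η) ⟨ht, hx, hη⟩).2) hy
  refine (h.solution.abs_sub_le_of_min_le h.reference hb (h.bounds.mono hbound)
    (h.bounds_reference.mono hbound) ht hx hy.1 (fun η hη => h.abs_w_sub_le_exp hX hb.le hA.le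
      (Ioo_subset_Icc_self hα) hκ hpow hinflow ht hx hη) hρ₀
    ((min_le_left _ _).trans (le_sub_comm.1 hu))).trans_eq ?_
  ring

theorem eventually_abs_sub_lt {C₂ : ℝ} (hX : 0 < X) (hb : 0 < b) (hμ : 0 < μ) (hc : 0 < c)
    (h : ComparisonPair X (croccoDomain X) b (fun η => c * barrier μ η) ubar wbar u w)
    (hα : α ∈ Ioo (0 : ℝ) 1) (hκ : κ ∈ Ioc 0 (b ^ 2 * α * (1 - α)))
    (hinflow : ∀ τ ≥ 0, ∀ η ∈ Ico (0 : ℝ) 1,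
      |w τ 0 η - wbar τ 0 η| ≤ Real.exp (-τ * κ) * C₂ * (1 - η) ^ α) (hε : 0 < ε) :
    ∀ᶠ t in atTop, ∀ p ∈ Icc 0 X ×ˢ Ici 0, |ubar t p.1 p.2 - u t p.1 p.2| < ε := by
  obtain ⟨A, hA, hpow⟩ := exists_mul_barrier_le_rpow hμ hc hα.2
  obtain ⟨B, hB, hbound⟩ := exists_mul_barrier_le hμ hc
  have hM : 0 < (ε / 2) ^ 3 * b ^ 2 / B := by positivity
  have hlim : Tendsto (fun t : ℝ => max A C₂ * Real.exp (-t * κ)) atTop (𝓝 0) := by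
    simpa using (Real.tendsto_exp_atBot.comp
      (tendsto_neg_atTop_atBot.atBot_mul_const hκ.1)).const_mul (max A C₂)
  filter_upwards [hlim.eventually (gt_mem_nhds hM), eventually_ge_atTop 0] with t htM ht p hp
  rw [abs_sub_comm]
  exact (h.solution.abs_sub_le_of_abs_w_sub_le h.reference hb (h.bounds.mono hbound)
    (h.bounds_reference.mono hbound) ht hp.1 hp.2 (half_pos hε) fun η hη =>
      (h.abs_w_sub_le_exp hX hb.le hA.le (Ioo_subset_Icc_self hα) hκ.2 hpow hinflow ht hp.1
        hη).trans htM.le).trans_lt (half_lt_self hε)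

end ComparisonPair

/-- A comparison pair whose data satisfy the bounds of the paper on the Crocco transform,
`c₀ (1 - η) ≤ w ≤ c₀⁻¹ (1 - η) √(-ln (μ (1 - η)))`. -/
abbrev DataPair (X μ c₀ : ℝ) (ubar wbar u w : ℝ → ℝ → ℝ → ℝ) : Prop :=
  ComparisonPair X (parabolicBoundary X) c₀ (fun η => c₀⁻¹ * barrier μ η) ubar wbar u w

lemma DataPair.enclosed {c₀ : ℝ} (hX : 0 < X) (hμ : μ ∈ Ioc 0 (Real.exp (-(1 / 2))))
    (hc₀ : 0 < c₀) (h : DataPair X μ c₀ ubar wbar u w) :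
    ComparisonPair X (croccoDomain X) (bConst c₀ (betaConst μ c₀) X)
      (fun η => c₀⁻¹ * barrier μ η) ubar wbar u w where
  reference := h.reference
  solution := h.solution
  concave := h.concave
  bounds_reference := h.reference.enclosedOn hX hμ hc₀ h.bounds_reference
  bounds := h.solution.enclosedOn hX hμ hc₀ h.bounds

lemma StabilityHyp.dataPair {c₀ α₀ C₁ : ℝ} {ubar wbar : ℝ → ℝ → ℝ}
    (h : StabilityHyp X μ c₀ α₀ C₁ b ubar wbar u w) :
    DataPair X μ c₀ (fun _ => ubar) (fun _ => wbar) u w := by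
  have hbounds {w : ℝ → ℝ → ℝ → ℝ} (hw : DataBounds X μ c₀ α₀ C₁ b w) :
      EnclosedOn (parabolicBoundary X) c₀ (fun η => c₀⁻¹ * barrier μ η) w := by
    rintro ⟨τ, ξ, η⟩ ⟨⟨hτ, hξ, hη⟩, hbdry⟩
    have := (hw τ hτ ξ hξ η hη hbdry).1
    rwa [mul_assoc] at this
  exact ⟨h.steady.isMonotoneSolution, h.unsteady.isMonotoneSolution,
    fun p hp => h.concave p.2.1 hp.2.1 p.2.2 hp.2.2,
    hbounds h.data_bar, hbounds h.data⟩

end Stability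

end Prandtl

end

theorem theorem1p2_general (μ c₀ X : ℝ) (hμ : μ ∈ Set.Ioc 0 (Real.exp (-(1 / 2))))
    (hc₀ : 0 < c₀) (hX : 0 < X) :
    ∃ β > 0,
      (∀ ε > 0, ∃ δε > 0, ∀ ubar wbar u w, Prandtl.DataPair X μ c₀ ubar wbar u w →
        (∀ t ≥ 0, ∀ y ≥ 0, |Prandtl.dY u t 0 y - Prandtl.dY ubar t 0 y| ≤ δε) →
        (∀ x ∈ Set.Icc 0 X, ∀ y ≥ 0, |Prandtl.dY u 0 x y - Prandtl.dY ubar 0 x y| ≤ δε) →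
        ∀ t ≥ 0, ∀ x ∈ Set.Icc 0 X, ∀ y ≥ 0, |ubar t x y - u t x y| ≤ ε) ∧
      ∀ α₀ ∈ Set.Ioo (0 : ℝ) 1, ∀ C₂ : ℝ,
        (∀ y₀ : ℝ, ∃ C > 0, ∀ β₀ ≤ Prandtl.bConst c₀ β X ^ 2 * α₀ * (1 - α₀),
          ∀ ubar wbar u w, Prandtl.DataPair X μ c₀ ubar wbar u w →
          (∀ τ ≥ 0, ∀ η ∈ Set.Ico (0 : ℝ) 1,
            |w τ 0 η - wbar τ 0 η| ≤ Real.exp (-τ * β₀) * C₂ * (1 - η) ^ α₀) →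
          ∀ t ≥ 0, ∀ x ∈ Set.Icc 0 X, ∀ y ∈ Set.Icc 0 y₀,
            |u t x y - ubar t x y| ≤ C * Real.exp (-t * β₀)) ∧
        (∀ β₀ ∈ Set.Ioc 0 (Prandtl.bConst c₀ β X ^ 2 * α₀ * (1 - α₀)),
          ∀ ubar wbar u w, Prandtl.DataPair X μ c₀ ubar wbar u w →
          (∀ τ ≥ 0, ∀ η ∈ Set.Ico (0 : ℝ) 1,
            |w τ 0 η - wbar τ 0 η| ≤ Real.exp (-τ * β₀) * C₂ * (1 - η) ^ α₀) →
          ∀ ε > 0, ∀ᶠ t in Filter.atTop, ∀ p ∈ Set.Icc 0 X ×ˢ Set.Ici 0,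
            |ubar t p.1 p.2 - u t p.1 p.2| < ε) := by
  have hc : 0 < c₀⁻¹ := inv_pos.2 hc₀
  have hb := Prandtl.bConst_pos (Prandtl.betaConst μ c₀) X hc₀
  obtain ⟨B, hB, hbound⟩ := Prandtl.exists_mul_barrier_le hμ.1 hc
  have hedge := mul_zero c₀⁻¹ ▸ (Prandtl.tendsto_barrier hμ.1).const_mul c₀⁻¹
  refine ⟨Prandtl.betaConst μ c₀, Prandtl.betaConst_pos hμ hc₀, fun ε hε => ?_,
    fun α₀ hα₀ C₂ => ⟨fun y₀ => ?_, fun β₀ hβ₀ ubar wbar u w h hinflow ε hε => ?_⟩⟩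
  · obtain ⟨δ, hδ, hstable⟩ :=
      Prandtl.ComparisonPair.exists_orbital_stability hX hb hB hbound hedge hε
    exact ⟨δ, hδ, fun ubar wbar u w h => hstable ubar wbar u w (h.enclosed hX hμ hc₀)⟩
  · obtain ⟨C, hC, hstable⟩ :=
      Prandtl.ComparisonPair.exists_local_exponential_stability hX hb hμ hc hα₀ y₀
    exact ⟨C, hC, fun β₀ hβ₀ ubar wbar u w h =>
      hstable β₀ hβ₀ ubar wbar u w (h.enclosed hX hμ hc₀)⟩
  · exact (h.enclosed hX hμ hc₀).eventually_abs_sub_lt hX hb hμ.1 hc hα₀ hβ₀ hinflow hε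


theorem theorem1p2 (μ c₀ X : ℝ) (hμ : μ ∈ Set.Ioo (0 : ℝ) (1 / 100))
    (hc₀ : c₀ ∈ Set.Ioo (0 : ℝ) 1) (hX : 0 < X) :
    ∃ β > 0, ∀ α₀ ∈ Set.Ioo (0 : ℝ) 1,
      -- orbital stability
      (∀ C₁ > 0, ∀ ε > 0, ∃ δε > 0, ∀ (ubar wbar : ℝ → ℝ → ℝ) (u w : ℝ → ℝ → ℝ → ℝ),
        Prandtl.StabilityHyp X μ c₀ α₀ C₁ (Prandtl.bConst c₀ β X) ubar wbar u w →
        (∀ t ≥ 0, ∀ y ≥ 0, |Prandtl.dY u t 0 y - Prandtl.dY (fun _ => ubar) t 0 y| ≤ δε) →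
        (∀ x ∈ Set.Icc 0 X, ∀ y ≥ 0,
          |Prandtl.dY u 0 x y - Prandtl.dY (fun _ => ubar) 0 x y| ≤ δε) →
        ∀ t ≥ 0, ∀ x ∈ Set.Icc 0 X, ∀ y ≥ 0, |ubar x y - u t x y| ≤ ε) ∧
      -- asymptotic stability: exponential rate on bounded sets of `y`
      (∀ C₂ > 0, ∀ y₀ > 0, ∃ C > 0, ∀ C₁ > 0,
        ∀ β₀ ∈ Set.Ioo 0 (Prandtl.bConst c₀ β X ^ 2 * α₀ * (1 - α₀)),
        ∀ (ubar wbar : ℝ → ℝ → ℝ) (u w : ℝ → ℝ → ℝ → ℝ),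
        Prandtl.StabilityHyp X μ c₀ α₀ C₁ (Prandtl.bConst c₀ β X) ubar wbar u w →
        (∀ τ ≥ 0, ∀ η ∈ Set.Ico (0 : ℝ) 1,
          |w τ 0 η - wbar 0 η| ≤ Real.exp (-τ * β₀) * C₂ * (1 - η) ^ α₀) →
        ∀ t ≥ 0, ∀ x ∈ Set.Icc 0 X, ∀ y ∈ Set.Icc 0 y₀,
          |u t x y - ubar x y| ≤ C * Real.exp (-t * β₀)) ∧
      -- asymptotic stability: uniform convergence on `[0, X] × [0, ∞)`
      (∀ C₂ > 0, ∀ C₁ > 0, ∀ β₀ ∈ Set.Ioo 0 (Prandtl.bConst c₀ β X ^ 2 * α₀ * (1 - α₀)),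
        ∀ (ubar wbar : ℝ → ℝ → ℝ) (u w : ℝ → ℝ → ℝ → ℝ),
        Prandtl.StabilityHyp X μ c₀ α₀ C₁ (Prandtl.bConst c₀ β X) ubar wbar u w →
        (∀ τ ≥ 0, ∀ η ∈ Set.Ico (0 : ℝ) 1,
          |w τ 0 η - wbar 0 η| ≤ Real.exp (-τ * β₀) * C₂ * (1 - η) ^ α₀) →
        TendstoUniformlyOn (fun (t : ℝ) (p : ℝ × ℝ) => u t p.1 p.2) (fun p => ubar p.1 p.2)
          Filter.atTop (Set.Icc 0 X ×ˢ Set.Ici 0)) := by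
  have hμ' : μ ∈ Set.Ioc 0 (Real.exp (-(1 / 2))) :=
    ⟨hμ.1, by linarith [hμ.2, Real.add_one_le_exp (-(1 / 2))]⟩
  obtain ⟨β, hβ, horbital, hasymptotic⟩ := theorem1p2_general μ c₀ X hμ' hc₀.1 hX
  refine ⟨β, hβ, fun α₀ hα₀ => ⟨fun C₁ _ ε hε => ?_, fun C₂ _ y₀ _ => ?_,
    fun C₂ _ C₁ _ β₀ hβ₀ ubar wbar u w h hinflow => ?_⟩⟩
  · obtain ⟨δ, hδ, hstable⟩ := horbital ε hε
    exact ⟨δ, hδ, fun ubar wbar u w h hinflow hinit t ht =>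
      hstable _ _ u w h.dataPair hinflow hinit t ht⟩
  · obtain ⟨C, hC, hstable⟩ := (hasymptotic α₀ hα₀ C₂).1 y₀
    exact ⟨C, hC, fun C₁ _ β₀ hβ₀ ubar wbar u w h hinflow t ht =>
      hstable β₀ hβ₀.2.le _ _ u w h.dataPair hinflow t ht⟩
  · exact Metric.tendstoUniformlyOn_iff.2
      ((hasymptotic α₀ hα₀ C₂).2 β₀ ⟨hβ₀.1, hβ₀.2.le⟩ _ _ u w h.dataPair hinflow)
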